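/- Fix delays $\delta,d,\tau>0$. Let $C_r=C([-r,0],\mathbb R^n)$ with the supremum norm $\|\cdot\|_c$, $\|\cdot\|$ the Euclidean norm, and $x_t(\theta)=x(t+\theta)$ for $\theta\in[-\delta,0]$. Consider $$\dot x(t)=f(x_t,u(t-d)),\qquad y(t)=h(x(t-\tau)),$$ where $f:C_\delta\times\mathbb R^p\to\mathbb R^n$ and $h:\mathbb R^n\to\mathbb R^q$ satisfy $f(0,0)=0$, $h(0)=0$, $\|f(\phi,u)-f(\varphi,v)\|\le L_f(\|\phi-\varphi\|_c+\|u-v\|)$ and $\|h(x)-h(z)\|\le L_h\|x-z\|$ for all arguments, with constants $L_f,L_h>0$. Assumption 1. $\alpha:\mathbb R^n\to\mathbb R^p$ is globally Lipschitz with $\alpha(0)=0$, and there are $a_1,a_2>0$ such that every solution of $\dot x(t)=f(x_t,\alpha(x(t)))$, $t\ge 0$, satisfies $\|x(t)\|\le a_1\|x_0\|_c e^{-a_2t}$ for all $t\ge0$. Assumption 2. $F:C_\delta\times\mathbb R^p\times\mathbb R^q\to\mathbb R^n$ satisfies $F(0,0,0)=0$ and $\|F(\phi,u,y)-F(\varphi,v,w)\|\le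 L_F(\|\phi-\varphi\|_c+\|u-v\|+\|y-w\|)$ with $L_F>0$, and there are $\lambda_1,\lambda_2>0$ such that for every continuous input $u$ on $[-d,\infty)$ all solutions of $\dot x(t)=f(x_t,u(t-d))$ and $\dot{\hat x}(t)=F(\hat x_t,u(t-d),h(x(t)))$, $t\ge0$, satisfy $\|x(t)-\hat x(t)\|\le\lambda_1\|x_0-\hat x_0\|_ce^{-\lambda_2t}$ for all $t\ge0$. Let $K=L_F+L_FL_h+1$ and let $m\in\mathbb N$ satisfy $m>K^2(d+\tau)$. Then the closed loop consisting of the system above, the output feedback $u(t)=\alpha(\hat z_m(t))$, $t\ge0$, and the chain of predictors, for $t\ge0$, $$\dot{\hat z}_0(t)=F\big(\hat z^0_t,\,u(t-d-\tau),\,y(t)\big),$$ $$\dot{\hat z}_i(t)=F\big(\hat z^i_t,\,u(t-d-\tau+\tfrac{i(d+\tau)}m),\,h(\hat z_i(t))\big)-K\big(\hat z_i(t-\tfrac{d+\tau}m)-\hat z_{i-1}(t)\big),\quad i=1,\dots,m$$ (where $\hat z^i_t(\theta)=\hat z_i(t+\theta)$ for $\theta\in[-\delta,0]$) is globally asymptotically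 stable. That is, there is a function $\beta$ of class $\mathcal{KL}$ such that for all initial histories $\psi$ of $x$ and $\varphi_0,\dots,\varphi_m$ of $\hat z_0,\dots,\hat z_m$ in $C_r$, $r=\max(\delta,d+\tau)$, and every continuous initial input $\nu\in C([-d-\tau,0],\mathbb R^p)$ (that is, $u=\nu$ on $[-d-\tau,0)$; in particular for the zero initial input $\nu=0$), a solution exists on $[0,\infty)$ and every solution satisfies $$\|x(t)\|+\sum_{i=0}^m\|\hat z_i(t)\|\le\beta\Big(\|\psi\|_c+\sum_{i=0}^m\|\varphi_i\|_c+\|\nu\|_c,\;t\Big)\quad\text{for all }t\ge0.$$ (Derivatives are right-hand derivatives, since $u$ may jump at $t=0$.) -/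

import Mathlib

open Set Filter Topology

/-- `ℝⁿ` with the Euclidean norm. -/
abbrev Vec (n : ℕ) : Type := EuclideanSpace ℝ (Fin n)

/-- `C([-r, 0], ℝⁿ)` with the supremum norm. -/
abbrev Hist (r : ℝ) (n : ℕ) : Type := C(Icc (-r) (0 : ℝ), Vec n)

/-- The history segment `x_t ∈ C([-r, 0], ℝⁿ)`, `x_t(θ) = x(t + θ)`.

A trajectory on `[-r, ∞)` is represented by a continuous function on `ℝ` of which only the values on
`[-r, ∞)` are ever used (every continuous function on `[-r, ∞)` has such an extension). -/
def seg (r : ℝ) {n : ℕ} (x : C(ℝ, Vec n)) (t : ℝ) : Hist r n where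
  toFun θ := x (t + θ)
  continuous_toFun := by fun_prop

/-- `x` satisfies `ẋ(t) = rhs(t)` for all `t ≥ 0`, with `ẋ` the right-hand derivative.
For continuous `rhs` this is the usual notion of a (continuously differentiable) solution; the
right-hand derivative only matters at the isolated instants at which the input jumps. -/
def SolvesFor {n : ℕ} (x : C(ℝ, Vec n)) (rhs : ℝ → Vec n) : Prop :=
  ∀ t : ℝ, 0 ≤ t → HasDerivWithinAt (fun s => x s) (rhs t) (Ici t) t

/-- Standing assumption on the plant `ẋ(t) = f(x_t, u(t - d))`, `y(t) = h(x(t - τ))`: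
`f` and `h` vanish at the origin and are globally Lipschitz with constants `Lf, Lh > 0`. -/
structure IsGLCPlant {n p q : ℕ} {δ : ℝ} (f : Hist δ n → Vec p → Vec n) (h : Vec n → Vec q)
    (Lf Lh : ℝ) : Prop where
  Lf_pos : 0 < Lf
  Lh_pos : 0 < Lh
  f_zero : f 0 0 = 0
  h_zero : h 0 = 0
  f_lip : ∀ (φ ψ : Hist δ n) (u v : Vec p), ‖f φ u - f ψ v‖ ≤ Lf * (‖φ - ψ‖ + ‖u - v‖)
  h_lip : ∀ x z : Vec n, ‖h x - h z‖ ≤ Lh * ‖x - z‖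

/-- `u = α(x)` is a globally Lipschitz feedback with `α(0) = 0` that makes the plant without input
delay, `ẋ(t) = f(x_t, α(x(t)))`, globally exponentially stable. -/
structure IsExpStabilizer {n p : ℕ} {δ : ℝ} (f : Hist δ n → Vec p → Vec n) (α : Vec n → Vec p) :
    Prop where
  zero : α 0 = 0
  lip : ∃ Lα : ℝ, 0 < Lα ∧ ∀ x z : Vec n, ‖α x - α z‖ ≤ Lα * ‖x - z‖
  ges : ∃ a₁ a₂ : ℝ, 0 < a₁ ∧ 0 < a₂ ∧
    ∀ x : C(ℝ, Vec n), SolvesFor x (fun t => f (seg δ x t) (α (x t))) →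
      ∀ t : ℝ, 0 ≤ t → ‖x t‖ ≤ a₁ * ‖seg δ x 0‖ * Real.exp (-a₂ * t)

/-- `F` vanishes at the origin, is globally Lipschitz with constant `LF > 0`, and
`x̂'(t) = F(x̂_t, u(t - d), y(t))` is a global exponential observer of the plant
`ẋ(t) = f(x_t, u(t - d))` with undelayed output `y(t) = h(x(t))`, uniformly over all
continuous inputs `u`. -/
structure IsExpObserver {n p q : ℕ} {δ : ℝ} (f : Hist δ n → Vec p → Vec n) (h : Vec n → Vec q)
    (d : ℝ) (F : Hist δ n → Vec p → Vec q → Vec n) (LF : ℝ) : Prop where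
  LF_pos : 0 < LF
  zero : F 0 0 0 = 0
  lip : ∀ (φ ψ : Hist δ n) (u v : Vec p) (y w : Vec q),
    ‖F φ u y - F ψ v w‖ ≤ LF * (‖φ - ψ‖ + ‖u - v‖ + ‖y - w‖)
  observer : ∃ l₁ l₂ : ℝ, 0 < l₁ ∧ 0 < l₂ ∧
    ∀ (u : C(ℝ, Vec p)) (x xh : C(ℝ, Vec n)),
      SolvesFor x (fun t => f (seg δ x t) (u (t - d))) →
      SolvesFor xh (fun t => F (seg δ xh t) (u (t - d)) (h (x t))) →
      ∀ t : ℝ, 0 ≤ t →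
        ‖x t - xh t‖ ≤ l₁ * ‖seg δ x 0 - seg δ xh 0‖ * Real.exp (-l₂ * t)

/-- Class `𝒦` functions on `[0, ∞)`. -/
structure IsClassK (γ : ℝ → ℝ) : Prop where
  continuousOn : ContinuousOn γ (Ici 0)
  strictMonoOn : StrictMonoOn γ (Ici 0)
  zero : γ 0 = 0

/-- Class `𝒦ℒ` functions on `[0, ∞) × [0, ∞)`. -/
structure IsClassKL (β : ℝ → ℝ → ℝ) : Prop where
  continuousOn : ContinuousOn (fun z : ℝ × ℝ => β z.1 z.2) (Ici 0 ×ˢ Ici 0)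
  classK : ∀ t : ℝ, 0 ≤ t → IsClassK (fun s => β s t)
  antitoneOn : ∀ s : ℝ, 0 ≤ s → AntitoneOn (β s) (Ici 0)
  tendsto : ∀ s : ℝ, 0 ≤ s → Tendsto (β s) atTop (𝓝 0)

/-- The closed loop of the plant with input delay `d` and output delay `τ`, the output feedback
`u(t) = α(z_m(t))`, `t ≥ 0`, and the chain of predictors `z_0, …, z_m` with gain `K` and step
`(d + τ)/m`. `u` is the applied input on `[-(d + τ), ∞)`, with initial input `ν`. The initial
histories `ψ` of `x` and `φ i` of `z_i` are given on `[-r, 0]` with `r = max δ (d + τ)`, which is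
long enough for all delayed terms. -/
structure IsClosedLoopSolution {n p q : ℕ} {δ : ℝ} (d τ : ℝ) (f : Hist δ n → Vec p → Vec n)
    (h : Vec n → Vec q) (α : Vec n → Vec p) (F : Hist δ n → Vec p → Vec q → Vec n) (K : ℝ) (m : ℕ)
    (ψ : Hist (max δ (d + τ)) n) (φ : Fin (m + 1) → Hist (max δ (d + τ)) n) (ν : Hist (d + τ) p)
    (u : ℝ → Vec p) (x : C(ℝ, Vec n)) (z : Fin (m + 1) → C(ℝ, Vec n)) : Prop where
  init_x : seg (max δ (d + τ)) x 0 = ψ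
  init_z : ∀ i, seg (max δ (d + τ)) (z i) 0 = φ i
  init_u : ∀ θ : Icc (-(d + τ)) (0 : ℝ), (θ : ℝ) < 0 → u θ = ν θ
  feedback : ∀ t : ℝ, 0 ≤ t → u t = α (z (Fin.last m) t)
  plant : SolvesFor x (fun t => f (seg δ x t) (u (t - d)))
  predictor_zero : SolvesFor (z 0) (fun t => F (seg δ (z 0) t) (u (t - d - τ)) (h (x (t - τ))))
  predictor_succ : ∀ i : Fin m, SolvesFor (z i.succ) (fun t =>
    F (seg δ (z i.succ) t) (u (t - d - τ + ((i : ℕ) + 1 : ℝ) * (d + τ) / m)) (h (z i.succ t))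
      - K • (z i.succ (t - (d + τ) / m) - z i.castSucc t))

/-- Global asymptotic stability of the closed loop: for all initial data there is a solution on
`[0, ∞)`, and all solutions obey one and the same class `𝒦ℒ` estimate. -/
def ClosedLoopGAS {n p q : ℕ} {δ : ℝ} (d τ : ℝ) (f : Hist δ n → Vec p → Vec n)
    (h : Vec n → Vec q) (α : Vec n → Vec p) (F : Hist δ n → Vec p → Vec q → Vec n) (K : ℝ)
    (m : ℕ) : Prop :=
  ∃ β : ℝ → ℝ → ℝ, IsClassKL β ∧
    ∀ (ψ : Hist (max δ (d + τ)) n) (φ : Fin (m + 1) → Hist (max δ (d + τ)) n)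
      (ν : Hist (d + τ) p),
      (∃ u x z, IsClosedLoopSolution d τ f h α F K m ψ φ ν u x z) ∧
      ∀ u x z, IsClosedLoopSolution d τ f h α F K m ψ φ ν u x z →
        ∀ t : ℝ, 0 ≤ t →
          ‖x t‖ + ∑ i, ‖z i t‖ ≤ β (‖ψ‖ + (∑ i, ‖φ i‖) + ‖ν‖) t

/-! Put D = d + τ and ε = D/m. Delaying the i-th predictor by iε, ζ_i(t) = z_i(t - iε), cancels the
input advance: every ζ_i is then driven by the same input u(t - D), which is also the input acting
on x(t - τ). Thus ζ_0 is the given observer for x(t - τ), and ζ_i is a copy of the observer, fed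
with its own output and coupled to ζ_{i-1} through -K(ζ_i - ζ_{i-1})(t - ε).

The synchronization errors e_i = ζ_i - ζ_{i-1} satisfy e_i'(t) = g(t) - K e_i(t - ε), where g is
bounded by (LF + LF Lh) = K - 1 times the supremum of e_i over a window of length δ, plus a defect
coming from ζ_{i-1}. Over one step of length ε the delayed term acts like an undelayed damping κ
e_i(t) with κ = K/(1 - Kε). The replacement error is small enough exactly because K²ε < 1, so
damping dominates and a Halanay argument gives exponential decay
(`exists_exp_bound_of_delayed_feedback`). The defect of ζ_i relative to the pure observer equation
is -K e_i(t - ε), which decays in turn, so induction along the chain applies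
(`uniformExpDecay_predictor_step`).

Consequently ζ_m(t) - x(t - τ) decays, that is, z_m(t) - x(t + d) decays: the plant receives α of
its current state up to an exponentially small error. A globally Lipschitz, exponentially
stabilizing feedback tolerates such an error (`exists_exp_bound_of_perturbed_feedback`), so x decays
and every z_i with it. Gronwall on bounded intervals makes the overshoot proportional to the size of
the initial data. This yields a bound C s exp(-μt), which is of class KL. Existence is a contraction
argument in an exponentially weighted norm. -/

/-! ### Gronwall and Halanay inequalities for delayed equations. -/

/-- A continuous function whose value at each time is dominated by `B` plus a fraction `θ < 1` of
its running supremum is bounded by `B / (1 - θ)`. -/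
theorem le_div_of_le_add_mul_runningBound {w : ℝ → ℝ} (hw : Continuous w) (hw0 : ∀ t, 0 ≤ w t)
    {a B θ : ℝ} (hθ : θ < 1)
    (h : ∀ t, a ≤ t → ∀ M, 0 ≤ M → (∀ s ∈ Icc a t, w s ≤ M) → w t ≤ B + θ * M) :
    ∀ t, a ≤ t → w t ≤ B / (1 - θ) := by
  intro t ht
  obtain ⟨s, hs, hmax⟩ := isCompact_Icc.exists_isMaxOn (nonempty_Icc.2 ht) hw.continuousOn
  -- At the maximum point the running bound M can be taken to be the value itself, so θM is absorbed
  -- on the left.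
  have h1 := h s hs.1 (w s) (hw0 s) fun s' hs' => hmax ⟨hs'.1, hs'.2.trans hs.2⟩
  have h2 : w t ≤ w s := hmax ⟨ht, le_rfl⟩
  rw [le_div_iff₀ (by linarith)]
  nlinarith

section

variable {E : Type*} [NormedAddCommGroup E] [NormedSpace ℝ E]

/-- Norm bound for a curve whose right derivative is dominated by the derivative of `B`. -/
theorem norm_le_of_right_deriv_le {X v : ℝ → E} (hX : Continuous X) {a b : ℝ} (hab : a ≤ b)
    (hv : ∀ s ∈ Ico a b, HasDerivWithinAt X (v s) (Ici s) s) {B B' : ℝ → ℝ}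
    (hB : ∀ s, HasDerivAt B (B' s) s) (ha : ‖X a‖ ≤ B a) (hle : ∀ s ∈ Ico a b, ‖v s‖ ≤ B' s) :
    ‖X b‖ ≤ B b :=
  image_norm_le_of_norm_deriv_right_le_deriv_boundary hX.continuousOn hv ha hB hle
    (right_mem_Icc.2 hab)

/-- A Gronwall estimate for functional differential inequalities. -/
theorem norm_le_exp_of_delayed_linear_growth {X v : ℝ → E} (hX : Continuous X) {r L N : ℝ}
    (hr : 0 ≤ r) (hL : 0 < L) (hN : 0 ≤ N) (hinit : ∀ s ∈ Icc (-r) 0, ‖X s‖ ≤ N)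
    (hv : ∀ t, 0 ≤ t → HasDerivWithinAt X (v t) (Ici t) t)
    (hle : ∀ t, 0 ≤ t → ∀ S, (∀ s ∈ Icc (-r) t, ‖X s‖ ≤ S) → ‖v t‖ ≤ L * (S + N)) :
    ∀ t, 0 ≤ t → ‖X t‖ ≤ 3 * N * Real.exp (2 * L * t) := by
  -- The weight exp(-2Lt) makes the memory term a fraction 1/2 of the running bound, since L
  -- exp(2Ls) integrates to at most exp(2Lt)/2. Clamping at 0 keeps the weight equal to 1 on the
  -- history.
  have key := le_div_of_le_add_mul_runningBound
    (w := fun t => Real.exp (-(2 * L * max t 0)) * ‖X t‖) (by fun_prop) (fun t => by positivity)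
    (a := -r) (B := 3 / 2 * N) (θ := 1 / 2) (by norm_num) ?_
  · intro t ht
    have := key t (by linarith)
    simp only [max_eq_left ht] at this
    rw [Real.exp_neg, inv_mul_le_iff₀ (Real.exp_pos _)] at this
    refine this.trans (le_of_eq ?_)
    ring
  intro t ht M hM hMt
  rcases le_or_gt t 0 with h0 | h0
  · simp only [max_eq_right h0, mul_zero, neg_zero, Real.exp_zero, one_mul]
    linarith [hinit t ⟨ht, h0⟩]
  simp only [max_eq_left h0.le]
  have hpast : ∀ s ∈ Icc (-r) t, ‖X s‖ ≤ Real.exp (2 * L * max s 0) * M := fun s hs => by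
    have := hMt s hs
    rwa [Real.exp_neg, inv_mul_le_iff₀ (Real.exp_pos _)] at this
  have hb := norm_le_of_right_deriv_le hX h0.le (v := v) (fun s hs => hv s hs.1)
    (B := fun s => N + (M + N) / 2 * Real.exp (2 * L * s))
    (B' := fun s => (M + N) / 2 * (Real.exp (2 * L * s) * (2 * L))) (fun s => by
      have h1 : HasDerivAt (fun s : ℝ => 2 * L * s) (2 * L) s := by
        simpa using (hasDerivAt_id s).const_mul (2 * L)
      exact (h1.exp.const_mul _).const_add N)
    (by have := hinit 0 ⟨by linarith, le_rfl⟩; simp; linarith) (fun s hs => by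
      have h1 : (1 : ℝ) ≤ Real.exp (2 * L * s) :=
        Real.one_le_exp (mul_nonneg (by linarith) hs.1)
      have := hle s hs.1 (Real.exp (2 * L * s) * M) fun s' hs' => by
        refine (hpast s' ⟨hs'.1, hs'.2.trans hs.2.le⟩).trans ?_
        gcongr
        exact max_le hs'.2 hs.1
      nlinarith [mul_le_mul_of_nonneg_left h1 (mul_nonneg hL.le hN)])
  have h1 : (1 : ℝ) ≤ Real.exp (2 * L * t) := Real.one_le_exp (by positivity)
  rw [Real.exp_neg, inv_mul_le_iff₀ (Real.exp_pos _)]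
  nlinarith [mul_le_mul_of_nonneg_left h1 hN]

/-- A Halanay-type inequality with an exponentially decaying perturbation. -/
theorem exists_exp_bound_of_halanay (E : Type*) [NormedAddCommGroup E] [NormedSpace ℝ E]
    {κ ρ r l : ℝ} (hκ : 0 < κ) (hρ0 : 0 ≤ ρ) (hρ : ρ < 1) (hr : 0 ≤ r)
    (hl : 0 < l) : ∃ C μ : ℝ, 0 < C ∧ 0 < μ ∧ ∀ (e v : ℝ → E), Continuous e → ∀ A, 0 ≤ A →
      (∀ s ∈ Icc (-r) 0, ‖e s‖ ≤ A) →
      (∀ t, 0 ≤ t → HasDerivWithinAt e (v t - κ • e t) (Ici t) t) →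
      (∀ t, 0 ≤ t → ∀ S, (∀ s ∈ Icc (t - r) t, ‖e s‖ ≤ S) →
        ‖v t‖ ≤ κ * ρ * S + A * Real.exp (-l * t)) →
      ∀ t, 0 ≤ t → ‖e t‖ ≤ C * A * Real.exp (-μ * t) := by
  -- At μ = 0 the quotient is ρ < 1; by continuity it stays below 1 for small positive μ.
  obtain ⟨μ, hμ0, hμl, hμκ, hθ⟩ : ∃ μ : ℝ, 0 < μ ∧ μ < l ∧ μ < κ ∧
      κ * ρ * Real.exp (μ * r) / (κ - μ) < 1 := by
    have hc : ContinuousAt (fun μ : ℝ => κ * ρ * Real.exp (μ * r) / (κ - μ)) 0 := by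
      apply ContinuousAt.div (by fun_prop) (by fun_prop)
      simpa using hκ.ne'
    have h1 : ∀ᶠ μ in 𝓝[>] (0 : ℝ), κ * ρ * Real.exp (μ * r) / (κ - μ) < 1 := by
      refine nhdsWithin_le_nhds (hc.eventually_lt continuousAt_const ?_)
      simp only [zero_mul, Real.exp_zero, mul_one, sub_zero]
      rwa [mul_div_cancel_left₀ _ hκ.ne']
    have h2 : ∀ᶠ μ in 𝓝[>] (0 : ℝ), μ ∈ Ioo 0 (min l κ) := Ioo_mem_nhdsGT (lt_min hl hκ)
    obtain ⟨μ, h1, h2⟩ := (h1.and h2).exists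
    exact ⟨μ, h2.1, h2.2.trans_le (min_le_left _ _), h2.2.trans_le (min_le_right _ _), h1⟩
  set θ := κ * ρ * Real.exp (μ * r) / (κ - μ) with hθdef
  have hκμ : 0 < κ - μ := by linarith
  have hθ0 : 0 ≤ θ := by positivity
  have hθ1 : 0 < 1 - θ := by linarith
  refine ⟨(1 + 1 / (κ - μ)) / (1 - θ), μ, by positivity, hμ0, ?_⟩
  intro e v he A hA hinit hv hle
  have key := le_div_of_le_add_mul_runningBound
    (w := fun t => Real.exp (μ * t) * ‖e t‖) (by fun_prop) (fun t => by positivity)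
    (a := -r) (B := A + A / (κ - μ)) (θ := θ) hθ ?_
  · intro t ht
    have := key t (by linarith)
    rw [neg_mul, Real.exp_neg, ← div_eq_mul_inv, le_div_iff₀ (Real.exp_pos _)]
    calc ‖e t‖ * Real.exp (μ * t) = Real.exp (μ * t) * ‖e t‖ := mul_comm _ _
      _ ≤ _ := this
      _ = _ := by field_simp
  intro t ht M hM hMt
  rcases le_or_gt t 0 with h0 | h0
  · have h1 : Real.exp (μ * t) ≤ 1 := Real.exp_le_one_iff.2 (by nlinarith)
    have h2 := hinit t ⟨ht, h0⟩
    have h3 : 0 ≤ A / (κ - μ) := by positivity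
    have h4 : 0 ≤ θ * M := by positivity
    nlinarith [norm_nonneg (e t), mul_le_mul h1 h2 (norm_nonneg _) zero_le_one]
  set Q := κ * ρ * (Real.exp (μ * r) * M) + A with hQ
  have hQ0 : 0 ≤ Q := by positivity
  -- The integrating factor exp(κs) removes the damping term. The comparison function B integrates
  -- the bound Q exp((κ - μ)s) on what remains.
  have hb := norm_le_of_right_deriv_le (X := fun s => Real.exp (κ * s) • e s)
    (v := fun s => Real.exp (κ * s) • v s) (by fun_prop) h0.le
    (fun s hs => by
      have h1 : HasDerivAt (fun s : ℝ => κ * s) κ s := by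
        simpa using (hasDerivAt_id s).const_mul κ
      refine (h1.exp.hasDerivWithinAt.smul (hv s hs.1)).congr_deriv ?_
      module)
    (B := fun s => A + Q / (κ - μ) * Real.exp ((κ - μ) * s))
    (B' := fun s => Q / (κ - μ) * (Real.exp ((κ - μ) * s) * (κ - μ))) (fun s => by
      have h1 : HasDerivAt (fun s : ℝ => (κ - μ) * s) (κ - μ) s := by
        simpa using (hasDerivAt_id s).const_mul (κ - μ)
      exact (h1.exp.const_mul _).const_add A)
    (by
      have h1 := hinit 0 ⟨by linarith, le_rfl⟩
      have h2 : 0 ≤ Q / (κ - μ) := by positivity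
      simp; linarith) (fun s hs => by
      have h1 := hle s hs.1 (Real.exp (μ * r) * M * Real.exp (-μ * s)) fun s' hs' => by
        rcases le_or_gt (-r) s' with h2 | h2
        · have h3 := hMt s' ⟨h2, hs'.2.trans hs.2.le⟩
          calc ‖e s'‖ = Real.exp (-(μ * s')) * (Real.exp (μ * s') * ‖e s'‖) := by
                rw [← mul_assoc, ← Real.exp_add]; simp
            _ ≤ Real.exp (μ * r + -μ * s) * M := by
                gcongr
                nlinarith [hs'.1]
            _ = _ := by rw [Real.exp_add]; ring
        · exact absurd hs'.1 (by linarith [hs.1])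
      rw [norm_smul, Real.norm_eq_abs, abs_of_pos (Real.exp_pos _)]
      have h2 : Real.exp (-l * s) ≤ Real.exp (-μ * s) := by
        gcongr
        nlinarith [hs.1]
      calc Real.exp (κ * s) * ‖v s‖ ≤ Real.exp (κ * s) * (Q * Real.exp (-μ * s)) := by
            gcongr
            refine h1.trans ?_
            rw [hQ]
            nlinarith [mul_le_mul_of_nonneg_left h2 hA]
        _ = Q * Real.exp (κ * s + -μ * s) := by rw [Real.exp_add]; ring
        _ = _ := by
            rw [show κ * s + -μ * s = (κ - μ) * s by ring]
            field_simp)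
  simp only [norm_smul, Real.norm_eq_abs, abs_of_pos (Real.exp_pos _)] at hb
  have h1 : Real.exp (-((κ - μ) * t)) ≤ 1 := Real.exp_le_one_iff.2 (by nlinarith)
  calc Real.exp (μ * t) * ‖e t‖ = Real.exp (-((κ - μ) * t)) * (Real.exp (κ * t) * ‖e t‖) := by
        rw [← mul_assoc, ← Real.exp_add]; congr 2; ring
    _ ≤ Real.exp (-((κ - μ) * t)) * (A + Q / (κ - μ) * Real.exp ((κ - μ) * t)) := by gcongr
    _ = Real.exp (-((κ - μ) * t)) * A + Q / (κ - μ) := by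
        rw [mul_add, mul_left_comm, ← Real.exp_add]; simp
    _ ≤ 1 * A + Q / (κ - μ) := by gcongr
    _ = _ := by rw [hQ, hθdef]; field_simp; ring

/-- Exponential decay for `ė(t) = g(t) - K e(t - ε)` when `g` is dominated by `K - 1` times the
running supremum of `e` and `K² ε < 1`. -/
theorem exists_exp_bound_of_delayed_feedback (E : Type*) [NormedAddCommGroup E] [NormedSpace ℝ E]
    {K ε δ l : ℝ} (hK : 1 ≤ K) (hε : 0 < ε) (hKε : K ^ 2 * ε < 1) (hδ : 0 ≤ δ) (hl : 0 < l) :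
    ∃ C μ : ℝ, 0 < C ∧ 0 < μ ∧ ∀ (e g : ℝ → E), Continuous e → ∀ A, 0 ≤ A →
      (∀ s ∈ Icc (-(δ + ε)) (2 * ε), ‖e s‖ ≤ A) →
      (∀ t, 0 ≤ t → HasDerivWithinAt e (g t - K • e (t - ε)) (Ici t) t) →
      (∀ t, 0 ≤ t → ∀ S, (∀ s ∈ Icc (t - δ) t, ‖e s‖ ≤ S) →
        ‖g t‖ ≤ (K - 1) * S + A * Real.exp (-l * t)) →
      ∀ t, 2 * ε ≤ t → ‖e t‖ ≤ C * A * Real.exp (-μ * t) := by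
  have ha : 0 < 1 - K * ε := by nlinarith
  -- One Euler step gives e(b) ≈ (1 - Kε) e(b - ε), hence K e(b - ε) ≈ κ e(b).
  set κ := K / (1 - K * ε) with hκdef
  have hκ : 0 < κ := by positivity
  -- The first term collects g at time b and its contribution to the Euler step; the second is the
  -- oscillation of e over one further delay. The sum is below 1 because 2K - 1 ≤ K² and K²ε < 1.
  set ρ := (K - 1) / K + K * (2 * K - 1) * ε ^ 2 with hρdef
  have hρ0 : 0 ≤ ρ := by
    have h1 : 0 ≤ K - 1 := by linarith
    have h2 : 0 ≤ 2 * K - 1 := by linarith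
    positivity
  have hρ : ρ < 1 := by
    have h1 : K ^ 2 * (2 * K - 1) * ε ^ 2 < 1 := by
      have h2 : (2 * K - 1) ≤ K ^ 2 := by nlinarith [sq_nonneg (K - 1)]
      calc K ^ 2 * (2 * K - 1) * ε ^ 2 ≤ K ^ 2 * K ^ 2 * ε ^ 2 := by gcongr
        _ = (K ^ 2 * ε) ^ 2 := by ring
        _ < 1 := by
          have : 0 ≤ K ^ 2 * ε := by positivity
          nlinarith
    have h3 : ρ = (K - 1 + K ^ 2 * (2 * K - 1) * ε ^ 2) / K := by
      rw [hρdef]; field_simp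
    rw [h3, div_lt_one (by linarith)]
    linarith
  have hκρ : κ * ρ = (K - 1) + κ * ε * ((K - 1) + K * ε * (2 * K - 1)) := by
    rw [hκdef, hρdef]
    field_simp
    ring
  -- Two steps of length ε are traced back from b = t + 2ε, and there g and the delayed term look
  -- back by δ and ε respectively, so a window of length δ + 3ε suffices.
  obtain ⟨C, μ, hC, hμ, hH⟩ := exists_exp_bound_of_halanay E hκ hρ0 hρ
    (r := δ + 3 * ε) (by linarith) hl
  set P := 1 + κ * ε * (1 + K * ε) with hP
  have hP1 : 1 ≤ P := by
    have : 0 ≤ κ * ε * (1 + K * ε) := by positivity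
    linarith
  refine ⟨C * P * Real.exp (μ * (2 * ε)), μ, by positivity, hμ, ?_⟩
  intro e g he A hA hinit hg hle t ht
  have hfin := hH (fun t => e (t + 2 * ε))
    (fun t => g (t + 2 * ε) - K • e (t + 2 * ε - ε) + κ • e (t + 2 * ε)) (by fun_prop) (P * A)
    (by positivity)
    (fun s hs => (hinit _ ⟨by linarith [hs.1], by linarith [hs.2]⟩).trans (by nlinarith))
    (fun t ht => by
      have h1 := (hg (t + 2 * ε) (by linarith)).scomp t
        (((hasDerivAt_id t).add_const (2 * ε)).hasDerivWithinAt (s := Ici t))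
        (fun s hs => by simpa using hs)
      simp only [one_smul, Function.comp_def, id] at h1
      convert h1 using 1
      module) ?_ (t - 2 * ε) (by linarith)
  · simp only [sub_add_cancel] at hfin
    refine hfin.trans (le_of_eq ?_)
    rw [show -μ * (t - 2 * ε) = μ * (2 * ε) + -μ * t by ring, Real.exp_add]
    ring
  intro t ht S hS
  set b := t + 2 * ε with hb
  have hS' : ∀ s ∈ Icc (t - δ - ε) b, ‖e s‖ ≤ S := fun s hs => by
    have := hS (s - 2 * ε) ⟨by linarith [hs.1], by linarith [hs.2]⟩
    simpa using this
  have hS0 : 0 ≤ S := (norm_nonneg _).trans (hS' b ⟨by linarith, le_rfl⟩)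
  set q := A * Real.exp (-l * t) with hq
  have hq0 : 0 ≤ q := by positivity
  have hgS : ∀ s ∈ Icc t b, ‖g s‖ ≤ (K - 1) * S + q := fun s hs => by
    refine (hle s (ht.trans hs.1) S fun s' hs' => hS' s' ⟨by linarith [hs'.1, hs.1],
      hs'.2.trans hs.2⟩).trans ?_
    have : Real.exp (-l * s) ≤ Real.exp (-l * t) := by
      gcongr 1
      nlinarith [hs.1]
    nlinarith
  have hV : ∀ s ∈ Icc t (t + ε), ‖g s - K • e (s - ε)‖ ≤ (2 * K - 1) * S + q := fun s hs => by
    have h1 := hgS s ⟨hs.1, by linarith [hs.2]⟩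
    have h2 := hS' (s - ε) ⟨by linarith [hs.1], by linarith [hs.2]⟩
    calc _ ≤ ‖g s‖ + ‖K • e (s - ε)‖ := norm_sub_le _ _
      _ = ‖g s‖ + K * ‖e (s - ε)‖ := by
        rw [norm_smul, Real.norm_eq_abs, abs_of_nonneg (by linarith)]
      _ ≤ (K - 1) * S + q + K * S := by gcongr
      _ = _ := by ring
  have hosc : ∀ s ∈ Icc t (t + ε), ‖e (t + ε) - e s‖ ≤ ((2 * K - 1) * S + q) * ε := fun s hs => by
    have h1 := norm_image_sub_le_of_norm_deriv_right_le_segment (f := e) (a := s) (b := t + ε)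
      (f' := fun s => g s - K • e (s - ε)) he.continuousOn
      (fun x hx => hg x (by linarith [hx.1, hs.1]))
      (fun x hx => hV x ⟨by linarith [hx.1, hs.1], hx.2.le⟩) (t + ε) ⟨hs.2, le_rfl⟩
    refine h1.trans ?_
    have : 0 ≤ (2 * K - 1) * S + q := by nlinarith
    gcongr
    linarith [hs.1]
  -- Adding the linear term leaves the derivative g(s) + K(e(t + ε) - e(s - ε)), so the increment
  -- over [t + ε, b] is the error of the Euler step, controlled by `hgS` and `hosc`.
  have hW := norm_image_sub_le_of_norm_deriv_right_le_segment
    (f := fun s => e s + (s - (t + ε)) • (K • e (t + ε))) (a := t + ε) (b := b)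
    (f' := fun s => (g s - K • e (s - ε)) + K • e (t + ε))
    (C := (K - 1) * S + q + K * (((2 * K - 1) * S + q) * ε))
    (by fun_prop)
    (fun s hs => by
      have h1 : HasDerivAt (fun s : ℝ => s - (t + ε)) 1 s := (hasDerivAt_id s).sub_const _
      have h2 := (h1.smul_const (K • e (t + ε))).hasDerivWithinAt (s := Ici s)
      rw [one_smul] at h2
      exact (hg s (by linarith [hs.1])).add h2)
    (fun s hs => by
      have h1 := hgS s ⟨by linarith [hs.1], hs.2.le⟩
      have h2 := hosc (s - ε) ⟨by linarith [hs.1], by linarith [hs.2]⟩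
      calc _ = ‖g s + K • (e (t + ε) - e (s - ε))‖ := by congr 1; module
        _ ≤ ‖g s‖ + ‖K • (e (t + ε) - e (s - ε))‖ := norm_add_le _ _
        _ = ‖g s‖ + K * ‖e (t + ε) - e (s - ε)‖ := by
          rw [norm_smul, Real.norm_eq_abs, abs_of_nonneg (by linarith)]
        _ ≤ _ := by gcongr) b ⟨by linarith, le_rfl⟩
  have hbε : b - ε = t + ε := by rw [hb]; ring
  have hgb := hgS b ⟨by linarith, le_rfl⟩
  calc ‖g b - K • e (b - ε) + κ • e b‖
      = ‖g b + κ • ((e b + (b - (t + ε)) • (K • e (t + ε))) -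
          (e (t + ε) + (t + ε - (t + ε)) • (K • e (t + ε))))‖ := by
        congr 1
        have h1 : K = κ * (1 - K * ε) := by rw [hκdef]; field_simp
        have h2 : b - (t + ε) = ε := by rw [hb]; ring
        rw [hbε, h2, sub_self, zero_smul, add_zero]
        have h3 : K • e (t + ε) = (κ * (1 - K * ε)) • e (t + ε) := by rw [← h1]
        rw [h3]
        have h4 : κ * (1 - K * ε) - κ = - (κ * ε * (κ * (1 - K * ε))) := by rw [← h1]; linarith
        have h5 : (κ * (1 - K * ε)) • e (t + ε) = κ • e (t + ε) -
          (κ * ε * (κ * (1 - K * ε))) • e (t + ε) := by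
          rw [← sub_smul]; congr 1; linarith
        rw [smul_sub, smul_add, smul_smul, smul_smul, h5]
        module
    _ ≤ ‖g b‖ + κ * ‖(e b + (b - (t + ε)) • (K • e (t + ε))) -
          (e (t + ε) + (t + ε - (t + ε)) • (K • e (t + ε)))‖ := by
        refine (norm_add_le _ _).trans (le_of_eq ?_)
        rw [norm_smul, Real.norm_eq_abs, abs_of_pos hκ]
    _ ≤ (K - 1) * S + q + κ * (((K - 1) * S + q + K * (((2 * K - 1) * S + q) * ε)) *
          (b - (t + ε))) := by gcongr
    _ = κ * ρ * S + P * A * Real.exp (-l * t) := by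
        rw [hκρ, show b - (t + ε) = ε by rw [hb]; ring, mul_assoc P, ← hq, hP]
        ring

end

/-! ### Global existence for causal Lipschitz equations. -/

/-- A locally bounded, right-continuous function on `[0, ∞)` has a primitive in the sense of right
derivatives. -/
theorem exists_hasDerivWithinAt_of_rightContinuous {E : Type*} [NormedAddCommGroup E]
    [NormedSpace ℝ E] [CompleteSpace E] {g : ℝ → E} (hmeas : MeasureTheory.StronglyMeasurable g)
    {b : ℝ → ℝ} (hb : Continuous b) (hgb : ∀ t, 0 ≤ t → ‖g t‖ ≤ b t)
    (hg : ∀ t, 0 ≤ t → ContinuousWithinAt g (Ici t) t) :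
    ∃ G : ℝ → E, Continuous G ∧ (∀ t, t ≤ 0 → G t = 0) ∧
      ∀ t, 0 ≤ t → HasDerivWithinAt G (g t) (Ici t) t := by
  set k : ℝ → E := fun t => g (max t 0) with hk
  have hkm : MeasureTheory.StronglyMeasurable k :=
    hmeas.comp_measurable (measurable_id.max measurable_const)
  have hki : ∀ a c, IntervalIntegrable k MeasureTheory.volume a c := fun a c => by
    refine IntervalIntegrable.mono_fun' (g := fun t => b (max t 0))
      (Continuous.intervalIntegrable (by fun_prop) _ _) hkm.aestronglyMeasurable ?_
    exact Eventually.of_forall fun t => hgb _ (le_max_right _ _)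
  have hcont := intervalIntegral.continuous_primitive hki 0
  refine ⟨fun t => ∫ s in (0 : ℝ)..max t 0, k s, hcont.comp (by fun_prop), fun t ht => by
    simp [max_eq_right ht], fun t ht => ?_⟩
  have hkt : ContinuousWithinAt k (Ici t) t := by
    refine ((hg t ht).congr (fun s hs => ?_) ?_)
    · simp only [hk]; rw [max_eq_left (ht.trans hs)]
    · simp only [hk]; rw [max_eq_left ht]
  have h1 : HasDerivWithinAt (fun u => ∫ s in (0 : ℝ)..u, k s) (k t) (Ici t) t :=
    intervalIntegral.integral_hasDerivWithinAt_right (hki 0 t) (t := Ioi t)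
      (hkm.stronglyMeasurableAtFilter) (hkt.mono Ioi_subset_Ici_self)
  have h2 : k t = g t := by simp only [hk]; rw [max_eq_left ht]
  rw [h2] at h1
  refine h1.congr (fun s hs => ?_) ?_
  · rw [max_eq_left (ht.trans hs)]
  · rw [max_eq_left ht]

/-- Global existence for functional differential equations with a causal, globally Lipschitz
right-hand side. -/
theorem exists_solution_of_causal_lipschitz {E : Type*} [NormedAddCommGroup E]
    [NormedSpace ℝ E] [CompleteSpace E] {G : C(ℝ, E) → ℝ → E} {r L B : ℝ} (hr : 0 ≤ r)
    (hL : 0 < L)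
    (hlip : ∀ X Y : C(ℝ, E), ∀ t, 0 ≤ t → ∀ S, (∀ s ∈ Icc (-r) t, ‖X s - Y s‖ ≤ S) →
      ‖G X t - G Y t‖ ≤ L * S)
    (hbdd : ∀ t, 0 ≤ t → ‖G 0 t‖ ≤ B)
    (hcont : ∀ X : C(ℝ, E), ∀ t, 0 ≤ t → ContinuousWithinAt (G X) (Ici t) t)
    (hmeas : ∀ X : C(ℝ, E), MeasureTheory.StronglyMeasurable (G X))
    (φ : C(Icc (-r) (0 : ℝ), E)) :
    ∃ X : C(ℝ, E), (∀ θ : Icc (-r) (0 : ℝ), X θ = φ θ) ∧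
      ∀ t, 0 ≤ t → HasDerivWithinAt X (G X t) (Ici t) t := by
  have hr' : -r ≤ 0 := by linarith
  set x₀ : ℝ → E := fun t => φ (projIcc (-r) 0 hr' t) with hx₀
  have hx₀c : Continuous x₀ := φ.continuous.comp continuous_projIcc
  have hx₀b : ∀ t, ‖x₀ t‖ ≤ ‖φ‖ := fun t => φ.norm_coe_le_norm _
  have hx₀θ : ∀ θ : Icc (-r) (0 : ℝ), x₀ θ = φ θ := fun θ => by simp [hx₀]
  have hx₀0 : ∀ t, 0 ≤ t → x₀ t = x₀ 0 := fun t ht => by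
    simp [hx₀, projIcc_of_right_le hr' ht]
  -- Candidates are written as exp(2Lt) times a bounded function. In this weighted norm the Picard
  -- map contracts by 1/2 on the whole half-line, so no continuation argument is needed.
  let W : (BoundedContinuousFunction ℝ E) → C(ℝ, E) := fun Y =>
    ⟨fun t => Real.exp (2 * L * max t 0) • Y t, by fun_prop⟩
  have hWsub : ∀ Y Z t, W Y t - W Z t = Real.exp (2 * L * max t 0) • (Y t - Z t) :=
    fun Y Z t => by simp [W, smul_sub]
  have hWd : ∀ Y Z, ∀ t, 0 ≤ t →
      ‖G (W Y) t - G (W Z) t‖ ≤ L * (Real.exp (2 * L * t) * dist Y Z) := fun Y Z t ht => by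
    refine hlip _ _ t ht _ fun s hs => ?_
    rw [hWsub, norm_smul, Real.norm_eq_abs, abs_of_pos (Real.exp_pos _), ← dist_eq_norm]
    gcongr
    · exact max_le hs.2 ht
    · exact BoundedContinuousFunction.dist_coe_le_dist _
  have hW0 : W 0 = 0 := by ext t; simp [W]
  have hprim : ∀ Y, ∃ P : ℝ → E, Continuous P ∧ (∀ t, t ≤ 0 → P t = 0) ∧
      ∀ t, 0 ≤ t → HasDerivWithinAt P (G (W Y) t) (Ici t) t := fun Y => by
    refine exists_hasDerivWithinAt_of_rightContinuous (hmeas _)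
      (b := fun t => B + L * (Real.exp (2 * L * t) * dist Y 0)) (by fun_prop) (fun t ht => ?_)
      (hcont _)
    have h1 := hWd Y 0 t ht
    rw [hW0] at h1
    have h2 := norm_add_le (G 0 t) (G (W Y) t - G 0 t)
    rw [add_sub_cancel] at h2
    linarith [hbdd t ht]
  choose P hPc hP0 hPd using hprim
  have hPdiff : ∀ Y Z t, Real.exp (-(2 * L * max t 0)) * ‖P Y t - P Z t‖ ≤ 1 / 2 * dist Y Z := by
    intro Y Z t
    rcases le_or_gt t 0 with h0 | h0
    · rw [hP0 Y t h0, hP0 Z t h0]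
      simp only [sub_self, norm_zero, mul_zero]
      positivity
    rw [max_eq_left h0.le, Real.exp_neg, inv_mul_le_iff₀ (Real.exp_pos _)]
    have h1 := norm_le_of_right_deriv_le (X := fun s => P Y s - P Z s)
      (v := fun s => G (W Y) s - G (W Z) s) ((hPc Y).sub (hPc Z)) h0.le
      (fun s hs => (hPd Y s hs.1).sub (hPd Z s hs.1))
      (B := fun s => 1 / 2 * dist Y Z * Real.exp (2 * L * s))
      (B' := fun s => 1 / 2 * dist Y Z * (Real.exp (2 * L * s) * (2 * L))) (fun s => by
        have h1 : HasDerivAt (fun s : ℝ => 2 * L * s) (2 * L) s := by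
          simpa using (hasDerivAt_id s).const_mul (2 * L)
        exact h1.exp.const_mul _)
      (by rw [hP0 Y 0 le_rfl, hP0 Z 0 le_rfl]; simp)
      (fun s hs => (hWd Y Z s hs.1).trans (le_of_eq (by ring)))
    linarith
  have hPb : ∀ Y, ∃ C, ∀ t, Real.exp (-(2 * L * max t 0)) * ‖P Y t‖ ≤ C := by
    intro Y
    have h0 : ∃ C, 0 ≤ C ∧ ∀ t, Real.exp (-(2 * L * max t 0)) * ‖P 0 t‖ ≤ C := by
      have hB : 0 ≤ B := (norm_nonneg _).trans (hbdd 0 le_rfl)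
      refine ⟨B / (2 * L), by positivity, fun t => ?_⟩
      rcases le_or_gt t 0 with h0 | h0
      · rw [hP0 _ t h0]
        simp only [norm_zero, mul_zero]
        positivity
      rw [max_eq_left h0.le, Real.exp_neg, inv_mul_le_iff₀ (Real.exp_pos _)]
      have h1 := norm_le_of_right_deriv_le (X := P 0) (v := fun s => G (W 0) s) (hPc 0) h0.le
        (fun s hs => hPd 0 s hs.1)
        (B := fun s => B / (2 * L) * Real.exp (2 * L * s))
        (B' := fun s => B / (2 * L) * (Real.exp (2 * L * s) * (2 * L))) (fun s => by
          have h1 : HasDerivAt (fun s : ℝ => 2 * L * s) (2 * L) s := by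
            simpa using (hasDerivAt_id s).const_mul (2 * L)
          exact h1.exp.const_mul _)
        (by
          rw [hP0 0 0 le_rfl, norm_zero]
          positivity)
        (fun s hs => by
          have h2 : (1 : ℝ) ≤ Real.exp (2 * L * s) :=
            Real.one_le_exp (mul_nonneg (by linarith) hs.1)
          rw [hW0]
          refine (hbdd s hs.1).trans ?_
          have h3 : B / (2 * L) * (Real.exp (2 * L * s) * (2 * L)) = B * Real.exp (2 * L * s) := by
            field_simp
          rw [h3]
          nlinarith)
      linarith
    obtain ⟨C, hC, h0⟩ := h0
    refine ⟨C + 1 / 2 * dist Y 0, fun t => ?_⟩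
    have h1 : ‖P Y t‖ ≤ ‖P 0 t‖ + ‖P Y t - P 0 t‖ := by
      have := norm_add_le (P 0 t) (P Y t - P 0 t)
      rwa [add_sub_cancel] at this
    have h2 := mul_le_mul_of_nonneg_left h1 (Real.exp_pos (-(2 * L * max t 0))).le
    rw [mul_add] at h2
    linarith [h0 t, hPdiff Y 0 t]
  let T : (BoundedContinuousFunction ℝ E) → (BoundedContinuousFunction ℝ E) := fun Y =>
    BoundedContinuousFunction.ofNormedAddCommGroup
      (fun t => Real.exp (-(2 * L * max t 0)) • (x₀ t + P Y t))
      (by have := hPc Y; fun_prop) (‖φ‖ + (hPb Y).choose) (fun t => by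
        have h1 : Real.exp (-(2 * L * max t 0)) ≤ 1 := Real.exp_le_one_iff.2 (by
          have := le_max_right t 0
          have : 0 ≤ 2 * L * max t 0 := by positivity
          linarith)
        rw [norm_smul, Real.norm_eq_abs, abs_of_pos (Real.exp_pos _)]
        calc _ ≤ Real.exp (-(2 * L * max t 0)) * (‖x₀ t‖ + ‖P Y t‖) := by
              gcongr; exact norm_add_le _ _
          _ = Real.exp (-(2 * L * max t 0)) * ‖x₀ t‖ + Real.exp (-(2 * L * max t 0)) * ‖P Y t‖ := by
              ring
          _ ≤ 1 * ‖φ‖ + (hPb Y).choose := by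
              gcongr
              · exact hx₀b t
              · exact (hPb Y).choose_spec t
          _ = _ := by ring)
  have hT : ContractingWith (1 / 2) T := by
    refine ⟨by norm_num, LipschitzWith.of_dist_le_mul fun Y Z => ?_⟩
    rw [BoundedContinuousFunction.dist_le (by positivity)]
    intro t
    simp only [T, BoundedContinuousFunction.coe_ofNormedAddCommGroup, dist_eq_norm, ← smul_sub,
      add_sub_add_left_eq_sub]
    rw [norm_smul, Real.norm_eq_abs, abs_of_pos (Real.exp_pos _), ← dist_eq_norm Y Z]
    simpa using hPdiff Y Z t
  set Y := ContractingWith.fixedPoint T hT with hY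
  have hfix : T Y = Y := hT.fixedPoint_isFixedPt
  have hWY : ∀ t, W Y t = x₀ t + P Y t := fun t => by
    conv_lhs => rw [← hfix]
    simp only [W, T, ContinuousMap.coe_mk, BoundedContinuousFunction.coe_ofNormedAddCommGroup,
      smul_smul, ← Real.exp_add]
    simp
  refine ⟨W Y, fun θ => ?_, fun t ht => ?_⟩
  · rw [hWY, hP0 _ _ θ.2.2, hx₀θ, add_zero]
  · refine ((hPd Y t ht).const_add (x₀ 0)).congr (fun s hs => ?_) ?_
    · rw [hWY, hx₀0 s (ht.trans hs)]
    · rw [hWY, hx₀0 t ht]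

/-! ### History segments and time shifts. -/

section Segments

variable {n : ℕ} {r : ℝ}

theorem norm_seg_sub_le {x y : C(ℝ, Vec n)} {t S : ℝ} (hr : 0 ≤ r)
    (h : ∀ s ∈ Icc (t - r) t, ‖x s - y s‖ ≤ S) : ‖seg r x t - seg r y t‖ ≤ S := by
  rw [ContinuousMap.norm_le _ ((norm_nonneg _).trans (h t ⟨by linarith, le_rfl⟩))]
  intro θ
  exact h (t + θ) ⟨by linarith [θ.2.1], by linarith [θ.2.2]⟩

theorem norm_seg_le {x : C(ℝ, Vec n)} {t S : ℝ} (hr : 0 ≤ r)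
    (h : ∀ s ∈ Icc (t - r) t, ‖x s‖ ≤ S) : ‖seg r x t‖ ≤ S := by
  rw [ContinuousMap.norm_le _ ((norm_nonneg _).trans (h t ⟨by linarith, le_rfl⟩))]
  intro θ
  exact h (t + θ) ⟨by linarith [θ.2.1], by linarith [θ.2.2]⟩

theorem norm_le_norm_seg (x : C(ℝ, Vec n)) {s t : ℝ} (hs : s ∈ Icc (t - r) t) :
    ‖x s‖ ≤ ‖seg r x t‖ := by
  have := (seg r x t).norm_coe_le_norm ⟨s - t, by linarith [hs.1], by linarith [hs.2]⟩
  simpa [seg] using this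

/-- Currying a jointly continuous map gives continuity into the supremum norm directly. -/
theorem continuous_seg (r : ℝ) (x : C(ℝ, Vec n)) : Continuous (seg r x) :=
  (ContinuousMap.curry ⟨fun a : ℝ × Icc (-r) (0 : ℝ) => x (a.1 + a.2), by fun_prop⟩).continuous

/-- The time shift of a trajectory. -/
def shift (x : C(ℝ, Vec n)) (c : ℝ) : C(ℝ, Vec n) := ⟨fun t => x (t + c), by fun_prop⟩

@[simp] theorem shift_apply (x : C(ℝ, Vec n)) (c t : ℝ) : shift x c t = x (t + c) := rfl

theorem seg_shift (x : C(ℝ, Vec n)) (c t : ℝ) : seg r (shift x c) t = seg r x (t + c) := by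
  ext θ
  simp [seg, add_right_comm]

theorem HasDerivWithinAt.comp_add_const_Ici {E : Type*} [NormedAddCommGroup E] [NormedSpace ℝ E]
    {x : ℝ → E} {v : E} {t c : ℝ} (h : HasDerivWithinAt x v (Ici (t + c)) (t + c)) :
    HasDerivWithinAt (fun s => x (s + c)) v (Ici t) t := by
  have h1 := h.scomp t (((hasDerivAt_id t).add_const c).hasDerivWithinAt (s := Ici t))
    (fun s hs => by simpa using hs)
  simpa [Function.comp_def] using h1

end Segments

/-! ### Robustness of the stabilizing feedback. -/

section Plant

variable {n p : ℕ} {δ : ℝ}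

theorem continuous_of_lipschitz₂ {f : Hist δ n → Vec p → Vec n} {L : ℝ}
    (hf : ∀ (φ ψ : Hist δ n) (u v : Vec p), ‖f φ u - f ψ v‖ ≤ L * (‖φ - ψ‖ + ‖u - v‖)) :
    Continuous fun a : Hist δ n × Vec p => f a.1 a.2 := by
  rw [continuous_iff_continuousAt]
  intro a
  rw [ContinuousAt, tendsto_iff_norm_sub_tendsto_zero]
  refine squeeze_zero (fun _ => norm_nonneg _) (fun b => hf b.1 a.1 b.2 a.2) ?_
  have : Continuous fun b : Hist δ n × Vec p => L * (‖b.1 - a.1‖ + ‖b.2 - a.2‖) := by fun_prop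
  simpa using this.tendsto a

/-- Robustness of global exponential stability: a globally Lipschitz, exponentially stabilizing
feedback that is applied with an exponentially decaying error gives exponential convergence. -/
theorem exists_exp_bound_of_perturbed_feedback {f : Hist δ n → Vec p → Vec n} {α : Vec n → Vec p}
    {L l : ℝ} (hδ : 0 ≤ δ) (hL : 0 < L) (hl : 0 < l) (f_zero : f 0 0 = 0)
    (hf : ∀ (φ ψ : Hist δ n) (u v : Vec p), ‖f φ u - f ψ v‖ ≤ L * (‖φ - ψ‖ + ‖u - v‖))
    (hα : IsExpStabilizer f α) :
    ∃ C μ : ℝ, 0 < C ∧ 0 < μ ∧ ∀ (X : C(ℝ, Vec n)) (w : ℝ → Vec p) (A : ℝ), 0 ≤ A →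
      (∀ s ∈ Icc (-δ) 0, ‖X s‖ ≤ A) → SolvesFor X (fun t => f (seg δ X t) (w t)) →
      (∀ t, 0 ≤ t → ‖w t - α (X t)‖ ≤ A * Real.exp (-l * t)) →
      ∀ t, 0 ≤ t → ‖X t‖ ≤ C * A * Real.exp (-μ * t) := by
  obtain ⟨Lα, hLα, hαlip⟩ := hα.lip
  obtain ⟨a₁, a₂, ha₁, ha₂, hges⟩ := hα.ges
  set Λ := L * (1 + Lα) with hΛdef
  have hΛ : 0 < Λ := by positivity
  have hαc : Continuous α :=
    (LipschitzWith.of_dist_le_mul (K := ⟨Lα, hLα.le⟩) fun x y => by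
      rw [dist_eq_norm, dist_eq_norm]; exact hαlip x y).continuous
  have hfc := continuous_of_lipschitz₂ hf
  -- The stability hypothesis only speaks of solutions that exist. The comparison below restarts a
  -- nominal solution from an arbitrary segment of X, so existence must be supplied.
  have hnominal : ∀ φ : Hist δ n, ∃ Y : C(ℝ, Vec n), (∀ θ : Icc (-δ) (0 : ℝ), Y θ = φ θ) ∧
      SolvesFor Y (fun t => f (seg δ Y t) (α (Y t))) := by
    intro φ
    have hc : ∀ X : C(ℝ, Vec n), Continuous fun t => f (seg δ X t) (α (X t)) := fun X =>
      hfc.comp ((continuous_seg δ X).prodMk (hαc.comp X.continuous))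
    refine exists_solution_of_causal_lipschitz
      (G := fun X t => f (seg δ X t) (α (X t))) (L := Λ) (B := 0) hδ hΛ
      (fun X Y t ht S hS => ?_) (fun t ht => ?_) (fun X t ht => (hc X).continuousWithinAt)
      (fun X => (hc X).stronglyMeasurable) φ
    · refine (hf _ _ _ _).trans ?_
      rw [hΛdef, mul_assoc, add_mul, one_mul]
      gcongr
      · exact norm_seg_sub_le hδ fun s hs => hS s ⟨by linarith [hs.1], hs.2⟩
      · exact (hαlip _ _).trans (by gcongr; exact hS t ⟨by linarith, le_rfl⟩)
    · have : seg δ (0 : C(ℝ, Vec n)) t = 0 := by ext θ; simp [seg]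
      simp [this, hα.zero, f_zero]
  obtain ⟨T, hT0, hT⟩ : ∃ T : ℝ, 0 < T ∧ a₁ * Real.exp (-a₂ * T) ≤ 1 / 4 := by
    have h1 : Tendsto (fun T : ℝ => a₁ * Real.exp (-(a₂ * T))) atTop (𝓝 (a₁ * 0)) :=
      (Real.tendsto_exp_neg_atTop_nhds_zero.comp (tendsto_id.const_mul_atTop ha₂)).const_mul a₁
    rw [mul_zero] at h1
    obtain ⟨T, h2, h3⟩ := ((h1.eventually (ge_mem_nhds (by norm_num : (0 : ℝ) < 1 / 4))).and
      (eventually_gt_atTop 0)).exists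
    exact ⟨T, h3, by simpa [neg_mul] using h2⟩
  -- A window of length T together with the segment length δ costs a factor exp(μ(T + δ)) ≤ 2; with
  -- the contraction 1/4 this leaves the fraction 1/2.
  obtain ⟨μ, hμ0, hμl, hμT⟩ : ∃ μ : ℝ, 0 < μ ∧ μ ≤ l ∧ Real.exp (μ * (T + δ)) ≤ 2 := by
    refine ⟨min l (Real.log 2 / (T + δ)), lt_min hl (by have := Real.log_pos one_lt_two; positivity),
      min_le_left _ _, ?_⟩
    calc _ ≤ Real.exp (Real.log 2) := by
          gcongr
          rw [← le_div_iff₀ (by positivity)]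
          exact min_le_right _ _
      _ = 2 := Real.exp_log two_pos
  set Q := Real.exp (2 * Λ * T) with hQ
  refine ⟨2 * (2 * a₁ + 6 * Q + 1), μ, by positivity, hμ0, ?_⟩
  intro X w A hA hinit hX hw
  -- Nominal decay from the segment at t₀, plus the Gronwall deviation caused by the input error,
  -- which is at most A exp(-l t₀) from t₀ on.
  have hstep : ∀ t₀, 0 ≤ t₀ → ∀ s, 0 ≤ s → ‖X (t₀ + s)‖ ≤
      a₁ * ‖seg δ X t₀‖ * Real.exp (-a₂ * s) +
        3 * (A * Real.exp (-l * t₀)) * Real.exp (2 * Λ * s) := by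
    intro t₀ ht₀ s hs
    obtain ⟨Y, hY0, hY⟩ := hnominal (seg δ X t₀)
    have hYseg : seg δ Y 0 = seg δ X t₀ := by
      refine ContinuousMap.ext fun θ => ?_
      rw [← hY0 θ]
      simp [seg]
    have hYb := hges Y hY s hs
    rw [hYseg] at hYb
    have hdiff := norm_le_exp_of_delayed_linear_growth
      (X := fun s => shift X t₀ s - Y s)
      (v := fun s => f (seg δ (shift X t₀) s) (w (s + t₀)) - f (seg δ Y s) (α (Y s)))
      (by fun_prop) hδ hΛ (N := A * Real.exp (-l * t₀)) (by positivity)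
      (fun s hs => by
        have := hY0 ⟨s, hs⟩
        simp only at this
        rw [this]
        simp only [seg, ContinuousMap.coe_mk, shift_apply, add_comm s, sub_self, norm_zero]
        positivity)
      (fun t ht => by
        refine HasDerivWithinAt.sub ?_ (hY t ht)
        rw [seg_shift]
        exact (hX (t + t₀) (by linarith)).comp_add_const_Ici)
      (fun t ht S hS => by
        refine (hf _ _ _ _).trans ?_
        have h1 := norm_seg_sub_le (x := shift X t₀) (y := Y) (t := t) hδ (S := S) fun s hs =>
          hS s ⟨by linarith [hs.1], hs.2⟩
        have h2 : ‖w (t + t₀) - α (X (t + t₀))‖ ≤ A * Real.exp (-l * t₀) := by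
          refine (hw _ (by linarith)).trans ?_
          gcongr 2
          nlinarith
        have h3 : ‖α (X (t + t₀)) - α (Y t)‖ ≤ Lα * S :=
          (hαlip _ _).trans (by gcongr; exact hS t ⟨by linarith, le_rfl⟩)
        have h4 := norm_sub_le_norm_sub_add_norm_sub (w (t + t₀)) (α (X (t + t₀))) (α (Y t))
        have h5 : 0 ≤ A * Real.exp (-l * t₀) := by positivity
        rw [hΛdef, mul_assoc]
        gcongr
        nlinarith) s hs
    have h1 := norm_add_le (Y s) (X (s + t₀) - Y s)
    rw [add_sub_cancel] at h1
    simp only [shift_apply] at hdiff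
    rw [add_comm t₀ s]
    linarith
  have key := le_div_of_le_add_mul_runningBound
    (w := fun t => Real.exp (μ * t) * ‖X t‖) (by fun_prop) (fun t => by positivity)
    (a := -δ) (B := A * (2 * a₁ + 6 * Q + 1)) (θ := 1 / 2) (by norm_num) ?_
  · intro t ht
    have := key t (by linarith)
    rw [neg_mul, Real.exp_neg, ← div_eq_mul_inv, le_div_iff₀ (Real.exp_pos _)]
    calc ‖X t‖ * Real.exp (μ * t) = Real.exp (μ * t) * ‖X t‖ := mul_comm _ _
      _ ≤ _ := this
      _ = _ := by ring
  intro t ht M hM hMt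
  rcases le_or_gt t 0 with h0 | h0
  · have h1 : Real.exp (μ * t) ≤ 1 := Real.exp_le_one_iff.2 (by nlinarith)
    have h2 := hinit t ⟨ht, h0⟩
    have h3 : 0 ≤ A * (2 * a₁ + 6 * Q) := by positivity
    nlinarith [norm_nonneg (X t), mul_le_mul h1 h2 (norm_nonneg _) zero_le_one]
  rcases le_or_gt t T with h1 | h1
  · have h2 := hstep 0 le_rfl t h0.le
    have h3 : ‖seg δ X 0‖ ≤ A := norm_seg_le hδ (by simpa using hinit)
    have h4 : Real.exp (-a₂ * t) ≤ 1 := Real.exp_le_one_iff.2 (by nlinarith)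
    have h5 : Real.exp (2 * Λ * t) ≤ Q := by rw [hQ]; gcongr
    have h6 : Real.exp (μ * t) ≤ 2 := le_trans (by gcongr; linarith) hμT
    rw [zero_add, mul_zero, Real.exp_zero, mul_one] at h2
    have h7 : ‖X t‖ ≤ a₁ * A * 1 + 3 * A * Q := h2.trans (by gcongr)
    calc Real.exp (μ * t) * ‖X t‖ ≤ 2 * (a₁ * A * 1 + 3 * A * Q) := by gcongr
      _ ≤ _ := by nlinarith
  · have h2 := hstep (t - T) (by linarith) T hT0.le
    rw [sub_add_cancel] at h2
    have h3 : ‖seg δ X (t - T)‖ ≤ Real.exp (-(μ * (t - (T + δ)))) * M := norm_seg_le hδ fun s hs => by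
      have h4 := hMt s ⟨by linarith [hs.1], by linarith [hs.2]⟩
      calc ‖X s‖ = Real.exp (-(μ * s)) * (Real.exp (μ * s) * ‖X s‖) := by
            rw [← mul_assoc, ← Real.exp_add]; simp
        _ ≤ _ := by
            gcongr
            linarith [hs.1]
    have h5 : Real.exp (μ * t) * Real.exp (-(μ * (t - (T + δ)))) ≤ 2 := by
      rw [← Real.exp_add]
      convert hμT using 2
      ring
    have h6 : Real.exp (μ * t) * Real.exp (-l * (t - T)) ≤ 2 := by
      rw [← Real.exp_add]
      refine le_trans ?_ hμT
      gcongr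
      nlinarith
    calc Real.exp (μ * t) * ‖X t‖
        ≤ Real.exp (μ * t) * (a₁ * (Real.exp (-(μ * (t - (T + δ)))) * M) * Real.exp (-a₂ * T) +
          3 * (A * Real.exp (-l * (t - T))) * Q) := by
          gcongr
          refine h2.trans ?_
          gcongr
      _ = (Real.exp (μ * t) * Real.exp (-(μ * (t - (T + δ))))) * M * (a₁ * Real.exp (-a₂ * T)) +
          3 * A * Q * (Real.exp (μ * t) * Real.exp (-l * (t - T))) := by ring
      _ ≤ 2 * M * (1 / 4) + 3 * A * Q * 2 := by gcongr
      _ ≤ _ := by nlinarith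

end Plant

/-! ### The closed loop as a single functional differential equation. -/

section Loop

variable {n p q : ℕ} {δ d τ : ℝ}

/-- The input on `[-(d + τ), ∞)` that is generated by the initial input `ν` and the signal `ζ`
under the feedback `α`. -/
noncomputable def appliedInput (hD : -(d + τ) ≤ 0) (α : Vec n → Vec p) (ν : Hist (d + τ) p)
    (ζ : ℝ → Vec n) (t : ℝ) : Vec p :=
  if t < 0 then ν (projIcc _ _ hD t) else α (ζ t)

/-- Only right continuity is available: the initial input need not match the feedback at time 0. -/
theorem continuousWithinAt_appliedInput {hD : -(d + τ) ≤ 0} {α : Vec n → Vec p}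
    (hα : Continuous α) (ν : Hist (d + τ) p) {ζ : ℝ → Vec n} (hζ : Continuous ζ) (t : ℝ) :
    ContinuousWithinAt (appliedInput hD α ν ζ) (Ici t) t := by
  rcases lt_or_ge t 0 with h | h
  · have h1 : Continuous fun s => ν (projIcc _ _ hD s) := ν.continuous.comp continuous_projIcc
    refine (h1.continuousAt.congr ?_).continuousWithinAt
    filter_upwards [Iio_mem_nhds h] with s hs
    simp [appliedInput, mem_Iio.1 hs]
  · refine (hα.comp hζ).continuousWithinAt.congr (fun s hs => ?_) ?_
    · simp [appliedInput, not_lt.2 (h.trans hs)]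
    · simp [appliedInput, not_lt.2 h]

theorem stronglyMeasurable_appliedInput {hD : -(d + τ) ≤ 0} {α : Vec n → Vec p}
    (hα : Continuous α) (ν : Hist (d + τ) p) {ζ : ℝ → Vec n} (hζ : Continuous ζ) :
    MeasureTheory.StronglyMeasurable (appliedInput hD α ν ζ) :=
  MeasureTheory.StronglyMeasurable.ite measurableSet_Iio
    (ν.continuous.comp continuous_projIcc).stronglyMeasurable (hα.comp hζ).stronglyMeasurable

theorem norm_appliedInput_sub_le {hD : -(d + τ) ≤ 0} {α : Vec n → Vec p} {Lα : ℝ} (hLα : 0 ≤ Lα)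
    (hα : ∀ x z : Vec n, ‖α x - α z‖ ≤ Lα * ‖x - z‖) (ν : Hist (d + τ) p) {ζ ξ : ℝ → Vec n}
    {t S : ℝ} (hS0 : 0 ≤ S) (hS : 0 ≤ t → ‖ζ t - ξ t‖ ≤ S) :
    ‖appliedInput hD α ν ζ t - appliedInput hD α ν ξ t‖ ≤ Lα * S := by
  unfold appliedInput
  split_ifs with h
  · simp only [sub_self, norm_zero]; positivity
  · exact (hα _ _).trans (by gcongr; exact hS (not_lt.1 h))

theorem norm_appliedInput_zero_le {hD : -(d + τ) ≤ 0} {α : Vec n → Vec p} (hα : α 0 = 0)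
    (ν : Hist (d + τ) p) (t : ℝ) : ‖appliedInput hD α ν (fun _ => 0) t‖ ≤ ‖ν‖ := by
  unfold appliedInput
  split_ifs with h
  · exact ν.norm_coe_le_norm _
  · simp [hα]

theorem continuous_of_lipschitz₃ {F : Hist δ n → Vec p → Vec q → Vec n} {L : ℝ}
    (hF : ∀ (φ ψ : Hist δ n) (u v : Vec p) (y w : Vec q),
      ‖F φ u y - F ψ v w‖ ≤ L * (‖φ - ψ‖ + ‖u - v‖ + ‖y - w‖)) :
    Continuous fun a : Hist δ n × Vec p × Vec q => F a.1 a.2.1 a.2.2 := by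
  rw [continuous_iff_continuousAt]
  intro a
  rw [ContinuousAt, tendsto_iff_norm_sub_tendsto_zero]
  refine squeeze_zero (fun _ => norm_nonneg _) (fun b => hF b.1 a.1 b.2.1 a.2.1 b.2.2 a.2.2) ?_
  have : Continuous fun b : Hist δ n × Vec p × Vec q =>
    L * (‖b.1 - a.1‖ + ‖b.2.1 - a.2.1‖ + ‖b.2.2 - a.2.2‖) := by fun_prop
  simpa using this.tendsto a

/-- State space of the plant together with its `m + 1` predictors. -/
abbrev LoopState (n m : ℕ) : Type := Vec n × (Fin (m + 1) → Vec n)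

/-- The plant component of a trajectory of the closed loop. -/
def plantPart {m : ℕ} (X : C(ℝ, LoopState n m)) : C(ℝ, Vec n) := ⟨fun t => (X t).1, by fun_prop⟩

/-- The component of the `i`-th predictor of a trajectory of the closed loop. -/
def predictorPart {m : ℕ} (X : C(ℝ, LoopState n m)) (i : Fin (m + 1)) : C(ℝ, Vec n) :=
  ⟨fun t => (X t).2 i, by fun_prop⟩

/-- The right-hand side of the closed loop. -/
noncomputable def loopField (hD : -(d + τ) ≤ 0) (f : Hist δ n → Vec p → Vec n)
    (h : Vec n → Vec q) (α : Vec n → Vec p) (F : Hist δ n → Vec p → Vec q → Vec n) (K : ℝ) (m : ℕ)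
    (ν : Hist (d + τ) p) (X : C(ℝ, LoopState n m)) (t : ℝ) : LoopState n m :=
  let u := appliedInput hD α ν (predictorPart X (Fin.last m))
  let z := predictorPart X
  (f (seg δ (plantPart X) t) (u (t - d)),
    Fin.cons (F (seg δ (z 0) t) (u (t - d - τ)) (h (plantPart X (t - τ))))
      fun i : Fin m =>
        F (seg δ (z i.succ) t) (u (t - d - τ + ((i : ℕ) + 1 : ℝ) * (d + τ) / m)) (h (z i.succ t))
          - K • (z i.succ (t - (d + τ) / m) - z i.castSucc t))

/-- Causality: the advanced input of a predictor never lies in the future, nor before the recorded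
initial input when t ≥ 0. -/
theorem predictor_input_time_mem {d τ : ℝ} (hD : 0 ≤ d + τ) {m : ℕ} (i : Fin m) {t : ℝ} :
    t - d - τ + ((i : ℕ) + 1 : ℝ) * (d + τ) / m ∈ Icc (t - (d + τ)) t := by
  have hm : (0 : ℝ) < m := by exact_mod_cast i.pos
  have hi : ((i : ℕ) + 1 : ℝ) ≤ m := by exact_mod_cast i.2
  have h1 : ((i : ℕ) + 1 : ℝ) * (d + τ) / m ≤ d + τ := by
    rw [div_le_iff₀ hm, mul_comm (d + τ)]
    gcongr
  have h2 : 0 ≤ ((i : ℕ) + 1 : ℝ) * (d + τ) / m := by positivity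
  constructor <;> linarith

variable {f : Hist δ n → Vec p → Vec n} {h : Vec n → Vec q} {α : Vec n → Vec p}
  {F : Hist δ n → Vec p → Vec q → Vec n} {Lf Lh Lα LF K : ℝ} {m : ℕ}

/-- A Lipschitz constant of the right-hand side of the closed loop. -/
def loopLip (Lf Lh Lα LF K : ℝ) : ℝ := Lf * (1 + Lα) + LF * (1 + Lα + Lh) + 2 * K

theorem norm_loopField_sub_le (hδ : 0 ≤ δ) (hd : 0 < d) (hτ : 0 < τ)
    (hplant : IsGLCPlant f h Lf Lh) (hLα : 0 ≤ Lα)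
    (hα : ∀ x z : Vec n, ‖α x - α z‖ ≤ Lα * ‖x - z‖) (hF : IsExpObserver f h d F LF)
    (hK : 0 ≤ K) (hD : -(d + τ) ≤ 0) (ν : Hist (d + τ) p) (X Y : C(ℝ, LoopState n m)) {t : ℝ}
    (ht : 0 ≤ t) {S : ℝ} (hS : ∀ s ∈ Icc (-max δ (d + τ)) t, ‖X s - Y s‖ ≤ S) :
    ‖loopField hD f h α F K m ν X t - loopField hD f h α F K m ν Y t‖ ≤
      loopLip Lf Lh Lα LF K * S := by
  have hLf := hplant.Lf_pos
  have hLh := hplant.Lh_pos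
  have hLF := hF.LF_pos
  have hr1 := le_max_left δ (d + τ)
  have hr2 := le_max_right δ (d + τ)
  have hS0 : 0 ≤ S := (norm_nonneg _).trans (hS t ⟨by linarith, le_rfl⟩)
  have hx : ∀ s ∈ Icc (-max δ (d + τ)) t, ‖plantPart X s - plantPart Y s‖ ≤ S :=
    fun s hs => (norm_fst_le (X s - Y s)).trans (hS s hs)
  have hz : ∀ i, ∀ s ∈ Icc (-max δ (d + τ)) t, ‖predictorPart X i s - predictorPart Y i s‖ ≤ S :=
    fun i s hs => ((norm_le_pi_norm (X s - Y s).2 i).trans (norm_snd_le (X s - Y s))).trans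
      (hS s hs)
  have hu : ∀ s ≤ t, ‖appliedInput hD α ν (predictorPart X (Fin.last m)) s -
      appliedInput hD α ν (predictorPart Y (Fin.last m)) s‖ ≤ Lα * S := fun s hs =>
    norm_appliedInput_sub_le hLα hα ν hS0 fun h0 => hz _ s ⟨by linarith, hs⟩
  have hxs : ‖seg δ (plantPart X) t - seg δ (plantPart Y) t‖ ≤ S :=
    norm_seg_sub_le hδ fun s hs => hx s ⟨by linarith [hs.1], hs.2⟩
  have hzs : ∀ i, ‖seg δ (predictorPart X i) t - seg δ (predictorPart Y i) t‖ ≤ S := fun i =>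
    norm_seg_sub_le hδ fun s hs => hz i s ⟨by linarith [hs.1], hs.2⟩
  have e1 : 0 ≤ Lf * (S + Lα * S) := by positivity
  have e2 : 0 ≤ LF * (S + Lα * S + Lh * S) := by positivity
  have e3 : 0 ≤ K * (S + S) := by positivity
  have hL : loopLip Lf Lh Lα LF K * S =
      Lf * (S + Lα * S) + LF * (S + Lα * S + Lh * S) + K * (S + S) := by
    unfold loopLip; ring
  rw [hL]
  refine max_le ?_ ?_
  · have : ‖(loopField hD f h α F K m ν X t).1 - (loopField hD f h α F K m ν Y t).1‖ ≤
        Lf * (S + Lα * S) := by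
      refine (hplant.f_lip _ _ _ _).trans ?_
      gcongr
      exact hu _ (by linarith)
    exact this.trans (by linarith)
  · refine (pi_norm_le_iff_of_nonneg (by positivity)).2 fun i => ?_
    refine Fin.cases ?_ (fun i => ?_) i
    · have : ‖F (seg δ (predictorPart X 0) t)
            (appliedInput hD α ν (predictorPart X (Fin.last m)) (t - d - τ))
            (h (plantPart X (t - τ))) - F (seg δ (predictorPart Y 0) t)
            (appliedInput hD α ν (predictorPart Y (Fin.last m)) (t - d - τ))
            (h (plantPart Y (t - τ)))‖ ≤ LF * (S + Lα * S + Lh * S) := by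
        refine (hF.lip _ _ _ _ _ _).trans ?_
        gcongr
        · exact hzs 0
        · exact hu _ (by linarith)
        · exact (hplant.h_lip _ _).trans
            (by gcongr; exact hx _ ⟨by linarith, by linarith⟩)
      exact this.trans (by linarith)
    · obtain ⟨j1, j2⟩ := predictor_input_time_mem (by linarith : 0 ≤ d + τ) i (t := t)
      have hm : (1 : ℝ) ≤ m := by exact_mod_cast i.pos
      have hs1 : (d + τ) / m ≤ d + τ := div_le_self (by linarith) hm
      have hs2 : 0 ≤ (d + τ) / m := by positivity
      have h1 : ‖F (seg δ (predictorPart X i.succ) t)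
            (appliedInput hD α ν (predictorPart X (Fin.last m))
              (t - d - τ + ((i : ℕ) + 1 : ℝ) * (d + τ) / m))
            (h (predictorPart X i.succ t)) - F (seg δ (predictorPart Y i.succ) t)
            (appliedInput hD α ν (predictorPart Y (Fin.last m))
              (t - d - τ + ((i : ℕ) + 1 : ℝ) * (d + τ) / m))
            (h (predictorPart Y i.succ t))‖ ≤ LF * (S + Lα * S + Lh * S) := by
        refine (hF.lip _ _ _ _ _ _).trans ?_
        gcongr
        · exact hzs _
        · exact hu _ j2
        · exact (hplant.h_lip _ _).trans
            (by gcongr; exact hz _ _ ⟨by linarith, le_rfl⟩)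
      have h2 := hz i.succ (t - (d + τ) / m) ⟨by linarith, by linarith⟩
      have h3 := hz i.castSucc t ⟨by linarith, le_rfl⟩
      have h4 : ‖K • ((predictorPart X i.succ (t - (d + τ) / m) -
            predictorPart Y i.succ (t - (d + τ) / m)) -
          (predictorPart X i.castSucc t - predictorPart Y i.castSucc t))‖ ≤ K * (S + S) := by
        rw [norm_smul, Real.norm_eq_abs, abs_of_nonneg hK]
        gcongr
        exact (norm_sub_le _ _).trans (add_le_add h2 h3)
      refine le_trans (le_trans (le_of_eq ?_) (norm_sub_le _ _))
        ((add_le_add h1 h4).trans (by linarith))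
      congr 1
      simp only [loopField, Prod.snd_sub, Pi.sub_apply, Fin.cons_succ]
      module

/-- At the zero trajectory only the initial input contributes, which gives the inhomogeneous term in
existence and in Gronwall. -/
theorem norm_loopField_zero_le (hplant : IsGLCPlant f h Lf Lh) (hLα : 0 ≤ Lα)
    (hα : α 0 = 0) (hF : IsExpObserver f h d F LF)
    (hK : 0 ≤ K) (hD : -(d + τ) ≤ 0) (ν : Hist (d + τ) p) (t : ℝ) :
    ‖loopField hD f h α F K m ν 0 t‖ ≤ loopLip Lf Lh Lα LF K * ‖ν‖ := by
  have hLf := hplant.Lf_pos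
  have hLh := hplant.Lh_pos
  have hLF := hF.LF_pos
  have hseg : seg δ (0 : C(ℝ, Vec n)) t = 0 := by ext θ; simp [seg]
  have hx : plantPart (0 : C(ℝ, LoopState n m)) = 0 := rfl
  have hz : ∀ i, predictorPart (0 : C(ℝ, LoopState n m)) i = 0 := fun i => rfl
  have hu : ∀ s, ‖appliedInput hD α ν (0 : C(ℝ, Vec n)) s‖ ≤ ‖ν‖ :=
    fun s => norm_appliedInput_zero_le hα ν s
  have hFb : ∀ v, ‖F 0 v 0‖ ≤ LF * ‖v‖ := fun v => by
    simpa [hF.zero] using hF.lip 0 0 v 0 0 0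
  have hfb : ∀ v, ‖f 0 v‖ ≤ Lf * ‖v‖ := fun v => by
    simpa [hplant.f_zero] using hplant.f_lip 0 0 v 0
  have h1 : Lf ≤ loopLip Lf Lh Lα LF K := by
    have : 0 ≤ Lf * Lα + LF * (1 + Lα + Lh) + 2 * K := by positivity
    unfold loopLip; linarith
  have h2 : LF ≤ loopLip Lf Lh Lα LF K := by
    have : 0 ≤ Lf * (1 + Lα) + LF * (Lα + Lh) + 2 * K := by positivity
    unfold loopLip; linarith
  have h0 : 0 ≤ loopLip Lf Lh Lα LF K := hLf.le.trans h1
  refine max_le ?_ ((pi_norm_le_iff_of_nonneg (by positivity)).2 fun i => ?_)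
  · simp only [loopField, hx, hz, hseg]
    exact (hfb _).trans (by gcongr; exact hu _)
  · refine Fin.cases ?_ (fun i => ?_) i
    · simp only [loopField, hx, hz, hseg, Fin.cons_zero, ContinuousMap.zero_apply, hplant.h_zero]
      exact (hFb _).trans (by gcongr; exact hu _)
    · simp only [loopField, hz, hseg, Fin.cons_succ, ContinuousMap.zero_apply, hplant.h_zero,
        sub_self, smul_zero, sub_zero]
      exact (hFb _).trans (by gcongr; exact hu _)

theorem continuousWithinAt_loopField (hf : Continuous fun a : Hist δ n × Vec p => f a.1 a.2)
    (hF : Continuous fun a : Hist δ n × Vec p × Vec q => F a.1 a.2.1 a.2.2)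
    (hh : Continuous h) (hα : Continuous α) (hD : -(d + τ) ≤ 0)
    (ν : Hist (d + τ) p) (X : C(ℝ, LoopState n m)) (t : ℝ) :
    ContinuousWithinAt (loopField hD f h α F K m ν X) (Ici t) t := by
  have hu : ∀ c, ContinuousWithinAt
      (fun s => appliedInput hD α ν (predictorPart X (Fin.last m)) (s + c)) (Ici t) t := fun c =>
    (continuousWithinAt_appliedInput hα ν (predictorPart X (Fin.last m)).continuous (t + c)).comp
      (t := Ici (t + c)) (f := fun s => s + c) (by fun_prop) (fun s hs => by simpa using hs)
  have hs := fun x : C(ℝ, Vec n) => (continuous_seg δ x).continuousWithinAt (s := Ici t) (x := t)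
  refine ContinuousWithinAt.prodMk ?_ (continuousWithinAt_pi.2 fun i => ?_)
  · exact hf.continuousAt.comp_continuousWithinAt ((hs (plantPart X)).prodMk (hu (-d)))
  · refine Fin.cases ?_ (fun i => ?_) i
    · simp only [Fin.cons_zero, sub_sub]
      exact hF.continuousAt.comp_continuousWithinAt ((hs (predictorPart X 0)).prodMk
        ((hu (-(d + τ))).prodMk (Continuous.continuousWithinAt (by fun_prop))))
    · simp only [Fin.cons_succ]
      refine ContinuousWithinAt.sub ?_ (Continuous.continuousWithinAt (by fun_prop))
      simp only [sub_sub, sub_add]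
      exact hF.continuousAt.comp_continuousWithinAt ((hs (predictorPart X i.succ)).prodMk
        ((hu (-_)).prodMk (Continuous.continuousWithinAt (by fun_prop))))

theorem stronglyMeasurable_loopField (hf : Continuous fun a : Hist δ n × Vec p => f a.1 a.2)
    (hF : Continuous fun a : Hist δ n × Vec p × Vec q => F a.1 a.2.1 a.2.2)
    (hh : Continuous h) (hα : Continuous α) (hD : -(d + τ) ≤ 0)
    (ν : Hist (d + τ) p) (X : C(ℝ, LoopState n m)) :
    MeasureTheory.StronglyMeasurable (loopField hD f h α F K m ν X) := by
  have hu : ∀ c, MeasureTheory.StronglyMeasurable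
      (fun s => appliedInput hD α ν (predictorPart X (Fin.last m)) (s + c)) := fun c =>
    (stronglyMeasurable_appliedInput hα ν (predictorPart X (Fin.last m)).continuous).comp_measurable
      (measurable_id.add_const c)
  have hs := fun x : C(ℝ, Vec n) => (continuous_seg δ x).stronglyMeasurable
  refine MeasureTheory.StronglyMeasurable.prodMk ?_ (measurable_pi_lambda _ fun i =>
    (?_ : MeasureTheory.StronglyMeasurable _).measurable).stronglyMeasurable
  · exact hf.comp_stronglyMeasurable ((hs (plantPart X)).prodMk (hu (-d)))
  · refine Fin.cases ?_ (fun i => ?_) i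
    · simp only [Fin.cons_zero, sub_sub]
      exact hF.comp_stronglyMeasurable ((hs (predictorPart X 0)).prodMk
        ((hu (-(d + τ))).prodMk (Continuous.stronglyMeasurable (by fun_prop))))
    · simp only [Fin.cons_succ]
      refine MeasureTheory.StronglyMeasurable.sub ?_ (Continuous.stronglyMeasurable (by fun_prop))
      simp only [sub_sub, sub_add]
      exact hF.comp_stronglyMeasurable ((hs (predictorPart X i.succ)).prodMk
        ((hu (-_)).prodMk (Continuous.stronglyMeasurable (by fun_prop))))

end Loop

/-! ### Calculus of uniformly exponentially decaying signals. -/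

section Decay

variable {Ω E : Type*} [NormedAddCommGroup E] {N : Ω → ℝ}

/-- The signals `v ω` decay exponentially, with a common rate and with overshoot proportional
to `N ω`. -/
def UniformExpDecay (N : Ω → ℝ) (v : Ω → ℝ → E) : Prop :=
  ∃ C μ : ℝ, 0 < C ∧ 0 < μ ∧ ∀ ω t, 0 ≤ t → ‖v ω t‖ ≤ C * N ω * Real.exp (-μ * t)

theorem UniformExpDecay.of_norm_le {E' : Type*} [NormedAddCommGroup E'] (hN : ∀ ω, 0 ≤ N ω)
    {v : Ω → ℝ → E} {w : Ω → ℝ → E'}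
    (hv : UniformExpDecay N v) (c : ℝ) (hw : ∀ ω t, 0 ≤ t → ‖w ω t‖ ≤ c * ‖v ω t‖) :
    UniformExpDecay N w := by
  obtain ⟨C, μ, hC, hμ, h⟩ := hv
  refine ⟨(|c| + 1) * C, μ, by positivity, hμ, fun ω t ht => (hw ω t ht).trans ?_⟩
  have := hN ω
  calc c * ‖v ω t‖ ≤ (|c| + 1) * ‖v ω t‖ := by
        gcongr
        linarith [le_abs_self c]
    _ ≤ (|c| + 1) * (C * N ω * Real.exp (-μ * t)) := by gcongr; exact h ω t ht
    _ = _ := by ring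

theorem UniformExpDecay.add (hN : ∀ ω, 0 ≤ N ω) {v w : Ω → ℝ → E} (hv : UniformExpDecay N v)
    (hw : UniformExpDecay N w) : UniformExpDecay N (fun ω t => v ω t + w ω t) := by
  obtain ⟨C, μ, hC, hμ, h⟩ := hv
  obtain ⟨C', μ', hC', hμ', h'⟩ := hw
  refine ⟨C + C', min μ μ', by positivity, lt_min hμ hμ', fun ω t ht => ?_⟩
  have := hN ω
  calc _ ≤ ‖v ω t‖ + ‖w ω t‖ := norm_add_le _ _
    _ ≤ C * N ω * Real.exp (-μ * t) + C' * N ω * Real.exp (-μ' * t) :=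
      add_le_add (h ω t ht) (h' ω t ht)
    _ ≤ C * N ω * Real.exp (-min μ μ' * t) + C' * N ω * Real.exp (-min μ μ' * t) := by
      gcongr
      · exact min_le_left _ _
      · exact min_le_right _ _
    _ = _ := by ring

theorem UniformExpDecay.sum (hN : ∀ ω, 0 ≤ N ω) {ι : Type*} (s : Finset ι) {v : ι → Ω → ℝ → E}
    (hv : ∀ i, UniformExpDecay N (v i)) : UniformExpDecay N (fun ω t => ∑ i ∈ s, v i ω t) := by
  classical
  induction s using Finset.induction_on with
  | empty =>
    refine ⟨1, 1, one_pos, one_pos, fun ω t _ => ?_⟩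
    have := hN ω
    simp only [Finset.sum_empty, norm_zero]
    positivity
  | insert i s hi ih =>
    simp only [Finset.sum_insert hi]
    exact (hv i).add hN ih

/-- A transient on [0, T] costs only the factor exp(μT), provided it is bounded by the size of the
data. -/
theorem UniformExpDecay.of_bound_of_shift (hN : ∀ ω, 0 ≤ N ω) {v : Ω → ℝ → E} {T C₀ : ℝ}
    (h₀ : ∀ ω, ∀ t ∈ Icc 0 T, ‖v ω t‖ ≤ C₀ * N ω) {C μ : ℝ} (hC : 0 < C) (hμ : 0 < μ)
    (h : ∀ ω t, T ≤ t → ‖v ω t‖ ≤ C * N ω * Real.exp (-μ * (t - T))) : UniformExpDecay N v := by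
  refine ⟨(|C₀| + C) * Real.exp (μ * T), μ, by positivity, hμ, fun ω t ht => ?_⟩
  have hNω := hN ω
  have e1 : Real.exp (-μ * (t - T)) = Real.exp (μ * T) * Real.exp (-μ * t) := by
    rw [← Real.exp_add]; congr 1; ring
  have e2 : (|C₀| + C) * Real.exp (μ * T) * N ω * Real.exp (-μ * t) =
      (|C₀| + C) * N ω * Real.exp (-μ * (t - T)) := by rw [e1]; ring
  rw [e2]
  rcases le_total t T with h1 | h1
  · calc ‖v ω t‖ ≤ C₀ * N ω := h₀ ω t ⟨ht, h1⟩
      _ ≤ (|C₀| + C) * N ω * 1 := by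
        rw [mul_one]; gcongr; linarith [le_abs_self C₀]
      _ ≤ _ := by
        gcongr
        exact Real.one_le_exp (by nlinarith)
  · refine (h ω t h1).trans ?_
    gcongr
    linarith [abs_nonneg C₀]

/-- A backward shift brings in values on [c, 0] that decay does not control, hence `h₀`; for c > 0
that hypothesis is vacuous. -/
theorem UniformExpDecay.comp_add (hN : ∀ ω, 0 ≤ N ω) {v : Ω → ℝ → E} (hv : UniformExpDecay N v)
    (c : ℝ) {C₀ : ℝ} (h₀ : ∀ ω, ∀ t ∈ Icc c 0, ‖v ω t‖ ≤ C₀ * N ω) :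
    UniformExpDecay N (fun ω t => v ω (t + c)) := by
  obtain ⟨C, μ, hC, hμ, h⟩ := hv
  rcases le_total 0 c with hc | hc
  · refine ⟨C, μ, hC, hμ, fun ω t ht => (h ω _ (by linarith)).trans ?_⟩
    have := hN ω
    gcongr 2
    nlinarith
  · refine UniformExpDecay.of_bound_of_shift hN (T := -c) (C₀ := C₀)
      (fun ω t ht => h₀ ω _ ⟨by linarith [ht.1], by linarith [ht.2]⟩) hC hμ fun ω t ht => ?_
    simpa using h ω (t + c) (by linarith)

end Decay

/-! ### Closed-loop trajectories and delayed predictors. -/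

/-- A solution of the closed loop together with its initial data. -/
structure LoopTrajectory {n p q : ℕ} {δ : ℝ} (d τ : ℝ) (f : Hist δ n → Vec p → Vec n)
    (h : Vec n → Vec q) (α : Vec n → Vec p) (F : Hist δ n → Vec p → Vec q → Vec n) (K : ℝ)
    (m : ℕ) where
  /-- The initial history of the plant. -/
  ψ : Hist (max δ (d + τ)) n
  /-- The initial histories of the predictors. -/
  φ : Fin (m + 1) → Hist (max δ (d + τ)) n
  /-- The initial input. -/
  ν : Hist (d + τ) p
  /-- The applied input. -/
  u : ℝ → Vec p
  /-- The state of the plant. -/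
  x : C(ℝ, Vec n)
  /-- The states of the predictors. -/
  z : Fin (m + 1) → C(ℝ, Vec n)
  isSolution : IsClosedLoopSolution d τ f h α F K m ψ φ ν u x z

namespace LoopTrajectory

variable {n p q : ℕ} {δ d τ : ℝ} {f : Hist δ n → Vec p → Vec n} {h : Vec n → Vec q}
  {α : Vec n → Vec p} {F : Hist δ n → Vec p → Vec q → Vec n} {Lf Lh LF K : ℝ} {m : ℕ}

/-- The size of the initial data. -/
noncomputable def size (ω : LoopTrajectory d τ f h α F K m) : ℝ := ‖ω.ψ‖ + (∑ i, ‖ω.φ i‖) + ‖ω.ν‖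

theorem size_nonneg (ω : LoopTrajectory d τ f h α F K m) : 0 ≤ ω.size := by
  unfold size; positivity

theorem norm_x_init_le (ω : LoopTrajectory d τ f h α F K m) {t : ℝ}
    (ht : t ∈ Icc (-max δ (d + τ)) 0) : ‖ω.x t‖ ≤ ω.size := by
  have h1 := norm_le_norm_seg (r := max δ (d + τ)) ω.x (s := t) (t := 0) (by rwa [zero_sub])
  rw [ω.isSolution.init_x] at h1
  have h2 : 0 ≤ ∑ i, ‖ω.φ i‖ := Finset.sum_nonneg fun i _ => norm_nonneg _
  have := norm_nonneg ω.ν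
  unfold size; linarith

theorem norm_z_init_le (ω : LoopTrajectory d τ f h α F K m) (i : Fin (m + 1)) {t : ℝ}
    (ht : t ∈ Icc (-max δ (d + τ)) 0) : ‖ω.z i t‖ ≤ ω.size := by
  have h1 := norm_le_norm_seg (r := max δ (d + τ)) (ω.z i) (s := t) (t := 0) (by rwa [zero_sub])
  rw [ω.isSolution.init_z i] at h1
  have h2 : ‖ω.φ i‖ ≤ ∑ i, ‖ω.φ i‖ :=
    Finset.single_le_sum (f := fun i => ‖ω.φ i‖) (fun _ _ => norm_nonneg _) (Finset.mem_univ i)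
  have := norm_nonneg ω.ν
  have := norm_nonneg ω.ψ
  unfold size; linarith

/-- The joint trajectory of plant and predictors. -/
def state (ω : LoopTrajectory d τ f h α F K m) : C(ℝ, LoopState n m) :=
  ⟨fun t => (ω.x t, fun i => ω.z i t), by fun_prop⟩

theorem u_eq_appliedInput (ω : LoopTrajectory d τ f h α F K m) (hD : -(d + τ) ≤ 0) {t : ℝ}
    (ht : -(d + τ) ≤ t) : ω.u t = appliedInput hD α ω.ν (ω.z (Fin.last m)) t := by
  unfold appliedInput
  split_ifs with h0
  · rw [projIcc_of_mem hD ⟨ht, h0.le⟩]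
    exact ω.isSolution.init_u ⟨t, ht, h0.le⟩ h0
  · exact ω.isSolution.feedback t (not_lt.1 h0)

theorem hasDerivWithinAt_state (ω : LoopTrajectory d τ f h α F K m) (hd : 0 < d) (hτ : 0 < τ)
    (hD : -(d + τ) ≤ 0) {t : ℝ} (ht : 0 ≤ t) :
    HasDerivWithinAt ω.state (loopField hD f h α F K m ω.ν ω.state t) (Ici t) t := by
  refine HasDerivWithinAt.prodMk ?_ (hasDerivWithinAt_pi.2 fun i => ?_)
  · have h1 := ω.isSolution.plant t ht
    simp only at h1
    rwa [ω.u_eq_appliedInput hD (by linarith)] at h1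
  · refine Fin.cases ?_ (fun i => ?_) i
    · have h1 := ω.isSolution.predictor_zero t ht
      simp only at h1
      rwa [ω.u_eq_appliedInput hD (by linarith)] at h1
    · have h1 := ω.isSolution.predictor_succ i t ht
      simp only at h1
      rwa [ω.u_eq_appliedInput hD
        (by linarith [(predictor_input_time_mem (by linarith : 0 ≤ d + τ) i (t := t)).1])] at h1

/-- On bounded time intervals the closed loop is bounded in terms of its initial data. -/
theorem exists_bound_on_Icc (hδ : 0 ≤ δ) (hd : 0 < d) (hτ : 0 < τ) (hplant : IsGLCPlant f h Lf Lh)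
    (hα : IsExpStabilizer f α) (hF : IsExpObserver f h d F LF) (hK : 0 ≤ K) (T : ℝ) :
    ∃ C : ℝ, 0 < C ∧ ∀ (ω : LoopTrajectory d τ f h α F K m), ∀ t ∈ Icc (-max δ (d + τ)) T,
      ‖ω.x t‖ ≤ C * ω.size ∧ ∀ i, ‖ω.z i t‖ ≤ C * ω.size := by
  obtain ⟨Lα, hLα, hαlip⟩ := hα.lip
  have hLf := hplant.Lf_pos
  have hLh := hplant.Lh_pos
  have hLF := hF.LF_pos
  set L := loopLip Lf Lh Lα LF K with hL
  have hL0 : 0 < L := by rw [hL]; unfold loopLip; positivity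
  have hD : -(d + τ) ≤ 0 := by linarith
  have hr : 0 ≤ max δ (d + τ) := le_max_of_le_left hδ
  refine ⟨3 * Real.exp (2 * L * max T 0), by positivity, fun ω t ht => ?_⟩
  have hN := ω.size_nonneg
  have hν : ‖ω.ν‖ ≤ ω.size := by
    have h1 : 0 ≤ ∑ i, ‖ω.φ i‖ := Finset.sum_nonneg fun i _ => norm_nonneg _
    have h2 := norm_nonneg ω.ψ
    unfold size
    linarith
  have hinit : ∀ s ∈ Icc (-max δ (d + τ)) 0, ‖ω.state s‖ ≤ ω.size := fun s hs =>
    max_le (ω.norm_x_init_le hs)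
      ((pi_norm_le_iff_of_nonneg hN).2 fun i => ω.norm_z_init_le i hs)
  -- Joint Gronwall estimate for plant and predictors: the Lipschitz bound handles the state, and
  -- the initial input enters through the extra summand N.
  have hb := norm_le_exp_of_delayed_linear_growth ω.state.continuous hr hL0 hN hinit
    (fun t ht => ω.hasDerivWithinAt_state hd hτ hD ht) (fun t ht S hS => by
      have h1 := norm_loopField_sub_le (m := m) hδ hd hτ hplant hLα.le hαlip hF hK hD ω.ν
        ω.state 0 ht (S := S) (by simpa using hS)
      have h2 := norm_loopField_zero_le (m := m) hplant hLα.le hα.zero hF hK hD ω.ν t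
      have h3 := norm_add_le (loopField hD f h α F K m ω.ν 0 t)
        (loopField hD f h α F K m ω.ν ω.state t - loopField hD f h α F K m ω.ν 0 t)
      rw [add_sub_cancel] at h3
      nlinarith)
  have hs : ‖ω.state t‖ ≤ 3 * Real.exp (2 * L * max T 0) * ω.size := by
    rcases le_total t 0 with h0 | h0
    · have h1 : 1 ≤ Real.exp (2 * L * max T 0) :=
        Real.one_le_exp (mul_nonneg (by linarith) (le_max_right _ _))
      nlinarith [hinit t ⟨ht.1, h0⟩]
    · calc _ ≤ 3 * ω.size * Real.exp (2 * L * t) := hb t h0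
        _ ≤ 3 * ω.size * Real.exp (2 * L * max T 0) := by
          gcongr
          exact ht.2.trans (le_max_left _ _)
        _ = _ := by ring
  exact ⟨(norm_fst_le (ω.state t)).trans hs, fun i =>
    ((norm_le_pi_norm (ω.state t).2 i).trans (norm_snd_le (ω.state t))).trans hs⟩

/-- The trajectory of the `i`-th predictor, delayed so that it tracks `x(t - τ)`. -/
noncomputable def delayedPredictor (ω : LoopTrajectory d τ f h α F K m) (i : Fin (m + 1)) : C(ℝ, Vec n) :=
  shift (ω.z i) (-((i : ℕ) * ((d + τ) / m)))

theorem delayedPredictor_time {d τ : ℝ} (hD : 0 ≤ d + τ) {m : ℕ} (i : Fin (m + 1)) :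
    ((i : ℕ) : ℝ) * ((d + τ) / m) ∈ Icc 0 (d + τ) := by
  refine ⟨by positivity, ?_⟩
  rcases Nat.eq_zero_or_pos m with rfl | hm
  · simpa using hD
  have hm' : (0 : ℝ) < m := by exact_mod_cast hm
  have hi : ((i : ℕ) : ℝ) ≤ m := by exact_mod_cast Nat.lt_succ_iff.1 i.2
  rw [mul_div_assoc', div_le_iff₀ hm', mul_comm (d + τ)]
  gcongr

/-- The delay cancels the input advance, so the input is u(t - (d + τ)) for every i; and both
coupling terms are now evaluated at the same time t - (d + τ)/m. The restriction t ≥ d + τ keeps the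
undelayed time nonnegative. -/
theorem hasDerivWithinAt_delayedPredictor_succ (ω : LoopTrajectory d τ f h α F K m)
    (hD : 0 ≤ d + τ) (i : Fin m) {t : ℝ} (ht : d + τ ≤ t) :
    HasDerivWithinAt (ω.delayedPredictor i.succ)
      (F (seg δ (ω.delayedPredictor i.succ) t) (ω.u (t - (d + τ)))
        (h (ω.delayedPredictor i.succ t)) -
        K • (ω.delayedPredictor i.succ (t - (d + τ) / m) -
          ω.delayedPredictor i.castSucc (t - (d + τ) / m))) (Ici t) t := by
  have hi := (delayedPredictor_time hD i.succ).2
  have h1 := (ω.isSolution.predictor_succ i (t + -((i.succ : Fin (m + 1)) * ((d + τ) / m)))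
    (by linarith)).comp_add_const_Ici
  refine h1.congr_deriv ?_
  simp only [delayedPredictor, seg_shift, shift_apply, Fin.val_succ, Fin.val_castSucc]
  have e1 : t + -(((i : ℕ) + 1 : ℕ) * ((d + τ) / m)) - d - τ + ((i : ℕ) + 1 : ℝ) * (d + τ) / m =
      t - (d + τ) := by push_cast; ring
  have e2 : t + -(((i : ℕ) + 1 : ℕ) * ((d + τ) / m)) - (d + τ) / m =
      t - (d + τ) / m + -(((i : ℕ) + 1 : ℕ) * ((d + τ) / m)) := by ring
  have e3 : t + -(((i : ℕ) + 1 : ℕ) * ((d + τ) / m)) =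
      t - (d + τ) / m + -((i : ℕ) * ((d + τ) / m)) := by push_cast; ring
  rw [e1, e2]
  rw [← e3]

end LoopTrajectory

/-! ### Exponential decay along the predictor chain. -/

namespace LoopTrajectory

variable {n p q : ℕ} {δ d τ : ℝ} {f : Hist δ n → Vec p → Vec n} {h : Vec n → Vec q}
  {α : Vec n → Vec p} {F : Hist δ n → Vec p → Vec q → Vec n} {Lf Lh LF K : ℝ} {m : ℕ}

/-- All delays here are at most d + τ, so this left endpoint keeps every evaluation inside the given
histories. -/
theorem exists_bound_delayed (hδ : 0 ≤ δ) (hd : 0 < d) (hτ : 0 < τ) (hplant : IsGLCPlant f h Lf Lh)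
    (hα : IsExpStabilizer f α) (hF : IsExpObserver f h d F LF) (hK : 0 ≤ K) (T : ℝ) :
    ∃ C : ℝ, 0 < C ∧ ∀ (ω : LoopTrajectory d τ f h α F K m), ∀ t ∈ Icc (d + τ - max δ (d + τ)) T,
      ‖ω.x (t - τ)‖ ≤ C * ω.size ∧ ∀ i, ‖ω.delayedPredictor i t‖ ≤ C * ω.size := by
  obtain ⟨C, hC, hb⟩ := exists_bound_on_Icc (m := m) hδ hd hτ hplant hα hF hK T
  refine ⟨C, hC, fun ω t ht => ⟨(hb ω _ ⟨by linarith [ht.1], by linarith [ht.2]⟩).1, fun i => ?_⟩⟩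
  have hi := delayedPredictor_time (by linarith : 0 ≤ d + τ) i
  exact (hb ω _ ⟨by linarith [ht.1, hi.2], by linarith [ht.2, hi.1]⟩).2 i

/-- The zeroth predictor observes the delayed state `x(t - τ)`. -/
theorem uniformExpDecay_observer (hδ : 0 ≤ δ) (hd : 0 < d) (hτ : 0 < τ)
    (hplant : IsGLCPlant f h Lf Lh) (hα : IsExpStabilizer f α) (hF : IsExpObserver f h d F LF)
    (hK : 0 ≤ K) :
    UniformExpDecay (size (d := d) (τ := τ) (f := f) (h := h) (α := α) (F := F) (K := K) (m := m))
      (fun ω t => ω.delayedPredictor 0 t - ω.x (t - τ)) := by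
  obtain ⟨C, hC, hb⟩ := exists_bound_delayed (m := m) (K := K) hδ hd hτ hplant hα hF hK (d + τ)
  obtain ⟨Lα, hLα, hαlip⟩ := hα.lip
  have hαc : Continuous α :=
    (LipschitzWith.of_dist_le_mul (K := ⟨Lα, hLα.le⟩) fun x y => by
      rw [dist_eq_norm, dist_eq_norm]; exact hαlip x y).continuous
  obtain ⟨l₁, l₂, hl₁, hl₂, hobs⟩ := hF.observer
  have hr1 := le_max_left δ (d + τ)
  have hr2 := le_max_right δ (d + τ)
  refine UniformExpDecay.of_bound_of_shift size_nonneg (T := d + τ) (C₀ := C + C)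
    (fun ω t ht => ?_) (C := l₁ * (C + C)) (by positivity) hl₂ (fun ω t ht => ?_)
  · have h1 := hb ω t ⟨by linarith [ht.1], ht.2⟩
    rw [add_mul]
    exact (norm_sub_le _ _).trans (add_le_add (h1.2 0) h1.1)
  have hz : ω.delayedPredictor 0 = ω.z 0 := by ext t; simp [delayedPredictor]
  have hu : ∀ s, 0 ≤ s → ω.u s = α (ω.z (Fin.last m) s) := ω.isSolution.feedback
  -- Both trajectories are shifted so that their input at time s is u(s) with s ≥ 0. There u is the
  -- feedback, which extends continuously as the observer hypothesis requires.
  have h1 := hobs ⟨fun s => α (ω.z (Fin.last m) (s + d)), by fun_prop⟩ (shift ω.x d)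
    (shift (ω.delayedPredictor 0) (d + τ)) (fun s hs => by
      have h2 := (ω.isSolution.plant (s + d) (by linarith)).comp_add_const_Ici
      simpa [seg_shift, hu s hs] using h2) (fun s hs => by
      have h2 := (ω.isSolution.predictor_zero (s + (d + τ)) (by linarith)).comp_add_const_Ici
      have e1 : s + (d + τ) - d - τ = s := by ring
      have e2 : s + (d + τ) - τ = s + d := by ring
      simpa [seg_shift, e1, e2, hu s hs, hz] using h2) (t - (d + τ)) (by linarith)
  have hinit : ‖seg δ (shift ω.x d) 0 - seg δ (shift (ω.delayedPredictor 0) (d + τ)) 0‖ ≤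
      (C + C) * ω.size := by
    rw [add_mul]
    refine (norm_sub_le _ _).trans (add_le_add ?_ ?_)
    · refine norm_seg_le hδ fun s hs => ?_
      have := (hb ω (s + (d + τ)) ⟨by linarith [hs.1], by linarith [hs.2]⟩).1
      rwa [show s + (d + τ) - τ = s + d by ring] at this
    · exact norm_seg_le hδ fun s hs =>
        (hb ω (s + (d + τ)) ⟨by linarith [hs.1], by linarith [hs.2]⟩).2 0
  rw [norm_sub_rev]
  simp only [shift_apply, sub_add_cancel, show t - (d + τ) + d = t - τ by ring] at h1
  refine h1.trans ?_
  rw [mul_assoc l₁ (C + C)]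
  gcongr

/-- If a predictor obeys the observer equation up to an exponentially decaying defect, then the
next predictor of the chain synchronizes with it. -/
theorem uniformExpDecay_predictor_step (hδ : 0 < δ) (hd : 0 < d) (hτ : 0 < τ)
    (hplant : IsGLCPlant f h Lf Lh) (hα : IsExpStabilizer f α) (hF : IsExpObserver f h d F LF)
    (hK : K = LF + LF * Lh + 1) (hm : K ^ 2 * (d + τ) < m) (i : Fin m)
    {ρ : LoopTrajectory d τ f h α F K m → ℝ → Vec n} (hρ : UniformExpDecay size ρ)
    (hderiv : ∀ ω t, d + τ ≤ t → HasDerivWithinAt (ω.delayedPredictor i.castSucc)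
      (F (seg δ (ω.delayedPredictor i.castSucc) t) (ω.u (t - (d + τ)))
        (h (ω.delayedPredictor i.castSucc t)) + ρ ω t) (Ici t) t) :
    UniformExpDecay size (fun (ω : LoopTrajectory d τ f h α F K m) t =>
      ω.delayedPredictor i.succ t - ω.delayedPredictor i.castSucc t) := by
  have hLF := hF.LF_pos
  have hLh := hplant.Lh_pos
  have hK1 : 1 ≤ K := by
    have : 0 ≤ LF * Lh := by positivity
    linarith
  have hm0 : (0 : ℝ) < m := by exact_mod_cast i.pos
  have hm1 : (1 : ℝ) ≤ m := by exact_mod_cast i.pos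
  have hD : 0 < d + τ := by linarith
  set ε := (d + τ) / m with hε
  have hε0 : 0 < ε := by positivity
  have hεD : ε ≤ d + τ := div_le_self hD.le hm1
  have hKε : K ^ 2 * ε < 1 := by
    rw [hε, ← mul_div_assoc, div_lt_one hm0]
    exact hm
  obtain ⟨C₁, μ₁, hC₁, hμ₁, hρb⟩ := hρ
  obtain ⟨C₂, hC₂, hb⟩ := exists_bound_delayed (m := m) (K := K) hδ.le hd hτ hplant hα hF (by linarith)
    (d + τ + 3 * ε)
  obtain ⟨C, μ, hC, hμ, hdecay⟩ :=
    exists_exp_bound_of_delayed_feedback (Vec n) hK1 hε0 hKε hδ.le hμ₁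
  have hr1 := le_max_left δ (d + τ)
  have hr2 := le_max_right δ (d + τ)
  have hbound : ∀ (ω : LoopTrajectory d τ f h α F K m),
      ∀ t ∈ Icc (d + τ - max δ (d + τ)) (d + τ + 3 * ε),
      ‖ω.delayedPredictor i.succ t - ω.delayedPredictor i.castSucc t‖ ≤ 2 * C₂ * ω.size :=
    fun ω t ht => by
      refine (norm_sub_le _ _).trans ((add_le_add ((hb ω t ht).2 _) ((hb ω t ht).2 _)).trans ?_)
      linarith
  refine UniformExpDecay.of_bound_of_shift size_nonneg (T := d + τ + 3 * ε) (C₀ := 2 * C₂)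
    (fun ω t ht => hbound ω t ⟨by linarith [ht.1], ht.2⟩)
    (C := C * (2 * C₂ + C₁)) (by positivity) hμ (fun ω t ht => ?_)
  have hN := ω.size_nonneg
  -- The error equation holds from d + τ on. Starting later by ε ensures that the required past, of
  -- length δ + ε, reaches back only to d + τ - δ, where the histories still give a bound.
  have hfin := hdecay
    (fun s => ω.delayedPredictor i.succ (s + (d + τ + ε)) -
      ω.delayedPredictor i.castSucc (s + (d + τ + ε)))
    (fun s => F (seg δ (ω.delayedPredictor i.succ) (s + (d + τ + ε)))
        (ω.u (s + (d + τ + ε) - (d + τ))) (h (ω.delayedPredictor i.succ (s + (d + τ + ε)))) -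
      F (seg δ (ω.delayedPredictor i.castSucc) (s + (d + τ + ε)))
        (ω.u (s + (d + τ + ε) - (d + τ))) (h (ω.delayedPredictor i.castSucc (s + (d + τ + ε)))) -
      ρ ω (s + (d + τ + ε)))
    (by fun_prop) ((2 * C₂ + C₁) * ω.size) (by positivity)
    (fun s hs => (hbound ω _ ⟨by linarith [hs.1], by linarith [hs.2]⟩).trans
      (by gcongr; linarith))
    (fun s hs => by
      have h1 := (ω.hasDerivWithinAt_delayedPredictor_succ hD.le i
        (t := s + (d + τ + ε)) (by linarith)).comp_add_const_Ici
      have h2 := (hderiv ω (s + (d + τ + ε)) (by linarith)).comp_add_const_Ici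
      refine (h1.sub h2).congr_deriv ?_
      rw [← hε, show s - ε + (d + τ + ε) = s + (d + τ + ε) - ε by ring]
      module)
    (fun s hs S hS => by
      have h1 : ‖seg δ (ω.delayedPredictor i.succ) (s + (d + τ + ε)) -
          seg δ (ω.delayedPredictor i.castSucc) (s + (d + τ + ε))‖ ≤ S :=
        norm_seg_sub_le hδ.le fun s' hs' => by
          have := hS (s' - (d + τ + ε)) ⟨by linarith [hs'.1], by linarith [hs'.2]⟩
          simpa using this
      have h2 := hS s ⟨by linarith, le_rfl⟩
      have h3 := (hρb ω (s + (d + τ + ε)) (by linarith)).trans (b := C₁ * ω.size *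
        Real.exp (-μ₁ * (s + (d + τ + ε)))) (c := (2 * C₂ + C₁) * ω.size * Real.exp (-μ₁ * s)) (by
          gcongr ?_ * _ * Real.exp ?_
          · linarith
          · nlinarith)
      refine (norm_sub_le _ _).trans (add_le_add ?_ h3)
      refine (hF.lip _ _ _ _ _ _).trans ?_
      have h4 := (hplant.h_lip (ω.delayedPredictor i.succ (s + (d + τ + ε)))
        (ω.delayedPredictor i.castSucc (s + (d + τ + ε)))).trans
        (mul_le_mul_of_nonneg_left h2 hLh.le)
      rw [sub_self, norm_zero, add_zero]
      -- The inputs coincide and drop out; the remaining constant LF + LF Lh is K - 1 by the choice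
      -- of gain.
      calc _ ≤ LF * (S + Lh * S) := by gcongr
        _ = (K - 1) * S := by rw [hK]; ring)
    (t - (d + τ + ε)) (by linarith)
  simp only [sub_add_cancel] at hfin
  refine hfin.trans ?_
  rw [← mul_assoc]
  gcongr 2
  nlinarith

/-- All predictors, suitably delayed, track `x(t - τ)`. -/
theorem uniformExpDecay_delayedPredictor (hδ : 0 < δ) (hd : 0 < d) (hτ : 0 < τ)
    (hplant : IsGLCPlant f h Lf Lh) (hα : IsExpStabilizer f α) (hF : IsExpObserver f h d F LF)
    (hK : K = LF + LF * Lh + 1) (hm : K ^ 2 * (d + τ) < m) (i : Fin (m + 1)) :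
    UniformExpDecay size (fun (ω : LoopTrajectory d τ f h α F K m) t =>
      ω.delayedPredictor i t - ω.x (t - τ)) := by
  have hLF := hF.LF_pos
  have hLh := hplant.Lh_pos
  have hK0 : 0 ≤ K := by rw [hK]; positivity
  have hD : 0 < d + τ := by linarith
  suffices H : UniformExpDecay size (fun (ω : LoopTrajectory d τ f h α F K m) t =>
      ω.delayedPredictor i t - ω.x (t - τ)) ∧
      ∃ ρ : LoopTrajectory d τ f h α F K m → ℝ → Vec n, UniformExpDecay size ρ ∧
        ∀ ω t, d + τ ≤ t → HasDerivWithinAt (ω.delayedPredictor i)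
          (F (seg δ (ω.delayedPredictor i) t) (ω.u (t - (d + τ)))
            (h (ω.delayedPredictor i t)) + ρ ω t) (Ici t) t from H.1
  induction i using Fin.induction with
  | zero =>
    have hobs := uniformExpDecay_observer (m := m) hδ.le hd hτ hplant hα hF hK0
    refine ⟨hobs, fun ω t => F (seg δ (ω.delayedPredictor 0) t) (ω.u (t - (d + τ)))
        (h (ω.x (t - τ))) - F (seg δ (ω.delayedPredictor 0) t) (ω.u (t - (d + τ)))
        (h (ω.delayedPredictor 0 t)),
      hobs.of_norm_le size_nonneg (LF * Lh) fun ω t ht => ?_, fun ω t ht => ?_⟩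
    · refine (hF.lip _ _ _ _ _ _).trans ?_
      rw [sub_self, norm_zero, sub_self, norm_zero, zero_add, zero_add, mul_assoc]
      gcongr
      rw [norm_sub_rev (ω.delayedPredictor 0 t)]
      exact hplant.h_lip _ _
    · have hz : ω.delayedPredictor 0 = ω.z 0 := by ext t; simp [delayedPredictor]
      rw [add_sub_cancel, hz, ← sub_sub]
      exact ω.isSolution.predictor_zero t (by linarith)
  | succ i ih =>
    obtain ⟨htrack, ρ, hρ, hderiv⟩ := ih
    have hstep := uniformExpDecay_predictor_step hδ hd hτ hplant hα hF hK hm i hρ hderiv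
    obtain ⟨C, hC, hb⟩ := exists_bound_delayed (m := m) (K := K) hδ.le hd hτ hplant hα hF hK0 0
    have hm1 : (1 : ℝ) ≤ m := by exact_mod_cast i.pos
    have hεD : (d + τ) / m ≤ d + τ := div_le_self hD.le hm1
    have hε0 : 0 ≤ (d + τ) / m := by positivity
    have hr := le_max_right δ (d + τ)
    -- The new defect is the coupling term. Clamping its time at 0 avoids values before the recorded
    -- histories; for t ≥ d + τ the clamp is inactive because (d + τ)/m ≤ d + τ.
    refine ⟨?_, fun ω t => -(K • (ω.delayedPredictor i.succ (max (t + -((d + τ) / m)) 0) -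
      ω.delayedPredictor i.castSucc (max (t + -((d + τ) / m)) 0))), ?_, fun ω t ht => ?_⟩
    · simpa using hstep.add size_nonneg htrack
    · have hext : UniformExpDecay size (fun (ω : LoopTrajectory d τ f h α F K m) t =>
          ω.delayedPredictor i.succ (max t 0) - ω.delayedPredictor i.castSucc (max t 0)) :=
        hstep.of_norm_le size_nonneg 1 fun ω t ht => by rw [max_eq_left ht, one_mul]
      refine (hext.comp_add size_nonneg (-((d + τ) / m)) (C₀ := C + C)
        fun ω t ht => ?_).of_norm_le size_nonneg K fun ω t ht => ?_
      · have h0 : (0 : ℝ) ∈ Icc (d + τ - max δ (d + τ)) 0 := ⟨by linarith, le_rfl⟩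
        rw [max_eq_right ht.2, add_mul]
        exact (norm_sub_le _ _).trans (add_le_add ((hb ω 0 h0).2 _) ((hb ω 0 h0).2 _))
      · rw [norm_neg, norm_smul, Real.norm_eq_abs, abs_of_nonneg hK0]
    · rw [← sub_eq_add_neg, ← sub_eq_add_neg, max_eq_left (by linarith)]
      exact ω.hasDerivWithinAt_delayedPredictor_succ hD.le i ht

/-- The state of the plant decays exponentially. -/
theorem uniformExpDecay_plant (hδ : 0 < δ) (hd : 0 < d) (hτ : 0 < τ)
    (hplant : IsGLCPlant f h Lf Lh) (hα : IsExpStabilizer f α) (hF : IsExpObserver f h d F LF)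
    (hK : K = LF + LF * Lh + 1) (hm : K ^ 2 * (d + τ) < m) :
    UniformExpDecay size (fun (ω : LoopTrajectory d τ f h α F K m) t => ω.x t) := by
  have hLF := hF.LF_pos
  have hLh := hplant.Lh_pos
  have hK0 : 0 ≤ K := by rw [hK]; positivity
  have hD : 0 < d + τ := by linarith
  have hm0 : (0 : ℝ) < m := lt_of_le_of_lt (by positivity) hm
  have hr1 := le_max_left δ (d + τ)
  have hr2 := le_max_right δ (d + τ)
  obtain ⟨Lα, hLα, hαlip⟩ := hα.lip
  -- For i = m the total delay is d + τ, so advancing by d + τ compares z_m(t) with x(t + d): the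
  -- last predictor anticipates the input delay.
  have htrack := (uniformExpDecay_delayedPredictor (m := m) hδ hd hτ hplant hα hF hK hm
    (Fin.last m)).comp_add size_nonneg (d + τ) (C₀ := 0)
    fun ω t ht => absurd (ht.1.trans ht.2) (by linarith)
  obtain ⟨C₁, μ₁, hC₁, hμ₁, hz⟩ := htrack
  obtain ⟨C₂, hC₂, hb⟩ := exists_bound_on_Icc (m := m) (K := K) hδ.le hd hτ hplant hα hF hK0 d
  obtain ⟨C, μ, hC, hμ, hdecay⟩ := exists_exp_bound_of_perturbed_feedback hδ.le hplant.Lf_pos hμ₁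
    hplant.f_zero hplant.f_lip hα
  have hx : UniformExpDecay size
      (fun (ω : LoopTrajectory d τ f h α F K m) t => ω.x (t + d)) := by
    refine ⟨C * (C₂ + Lα * C₁), μ, by positivity, hμ, fun ω t ht => ?_⟩
    have hN := ω.size_nonneg
    rw [mul_assoc C]
    refine hdecay (shift ω.x d) (fun s => α (ω.z (Fin.last m) s)) ((C₂ + Lα * C₁) * ω.size)
      (by positivity) (fun s hs => ?_) (fun s hs => ?_) (fun s hs => ?_) t ht
    · refine ((hb ω (s + d) ⟨by linarith [hs.1], by linarith [hs.2]⟩).1).trans ?_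
      gcongr
      have : 0 ≤ Lα * C₁ := by positivity
      linarith
    · have h1 := (ω.isSolution.plant (s + d) (by linarith)).comp_add_const_Ici
      simpa [seg_shift, ω.isSolution.feedback s hs] using h1
    · have h1 := hz ω s hs
      have e1 : s + (d + τ) + -((Fin.last m : ℕ) * ((d + τ) / m)) = s := by
        rw [Fin.val_last]
        field_simp
        ring
      have e2 : s + (d + τ) - τ = s + d := by ring
      simp only [delayedPredictor, shift_apply, e1, e2] at h1
      calc _ ≤ Lα * ‖ω.z (Fin.last m) s - ω.x (s + d)‖ := hαlip _ _
        _ ≤ Lα * (C₁ * ω.size * Real.exp (-μ₁ * s)) := by gcongr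
        _ ≤ C₂ * ω.size * Real.exp (-μ₁ * s) + Lα * (C₁ * ω.size * Real.exp (-μ₁ * s)) := by
          have : 0 ≤ C₂ * ω.size * Real.exp (-μ₁ * s) := by positivity
          linarith
        _ = _ := by ring
  have h2 := hx.comp_add size_nonneg (-d) (C₀ := C₂) fun ω t ht =>
    (hb ω (t + d) ⟨by linarith [ht.1], by linarith [ht.2]⟩).1
  simpa using h2

/-- The state of each predictor decays exponentially. -/
theorem uniformExpDecay_predictor (hδ : 0 < δ) (hd : 0 < d) (hτ : 0 < τ)
    (hplant : IsGLCPlant f h Lf Lh) (hα : IsExpStabilizer f α) (hF : IsExpObserver f h d F LF)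
    (hK : K = LF + LF * Lh + 1) (hm : K ^ 2 * (d + τ) < m) (i : Fin (m + 1)) :
    UniformExpDecay size (fun (ω : LoopTrajectory d τ f h α F K m) t => ω.z i t) := by
  have hr2 := le_max_right δ (d + τ)
  have hi := delayedPredictor_time (by linarith : 0 ≤ d + τ) i
  have hx := (uniformExpDecay_plant hδ hd hτ hplant hα hF hK hm).comp_add size_nonneg (-τ)
    (C₀ := 1) fun ω t ht => by
      rw [one_mul]
      exact ω.norm_x_init_le ⟨by linarith [ht.1], ht.2⟩
  -- The tracking error plus x(t - τ) is the delayed predictor itself; advancing time then recovers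
  -- z_i.
  have h1 := (uniformExpDecay_delayedPredictor hδ hd hτ hplant hα hF hK hm i).add size_nonneg hx
  simp only [← sub_eq_add_neg, sub_add_cancel] at h1
  have hb : ∀ (ω : LoopTrajectory d τ f h α F K m), ∀ t ∈ Icc ((i : ℕ) * ((d + τ) / m)) 0,
      ‖ω.delayedPredictor i t‖ ≤ 1 * ω.size := fun ω t ht => by
    rw [one_mul]
    exact ω.norm_z_init_le i ⟨by linarith [ht.1, hi.1], by linarith [ht.2, hi.1]⟩
  simpa [delayedPredictor] using h1.comp_add size_nonneg ((i : ℕ) * ((d + τ) / m)) hb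

end LoopTrajectory

/-! ### Existence for the closed loop and the KL estimate. -/

/-- For all initial data the closed loop has a solution on `[0, ∞)`. -/
theorem exists_isClosedLoopSolution {n p q : ℕ} {δ d τ : ℝ} {f : Hist δ n → Vec p → Vec n}
    {h : Vec n → Vec q} {α : Vec n → Vec p} {F : Hist δ n → Vec p → Vec q → Vec n}
    {Lf Lh LF K : ℝ} {m : ℕ} (hδ : 0 ≤ δ) (hd : 0 < d) (hτ : 0 < τ)
    (hplant : IsGLCPlant f h Lf Lh) (hα : IsExpStabilizer f α) (hF : IsExpObserver f h d F LF)
    (hK : 0 ≤ K) (ψ : Hist (max δ (d + τ)) n) (φ : Fin (m + 1) → Hist (max δ (d + τ)) n)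
    (ν : Hist (d + τ) p) : ∃ u x z, IsClosedLoopSolution d τ f h α F K m ψ φ ν u x z := by
  obtain ⟨Lα, hLα, hαlip⟩ := hα.lip
  have hLf := hplant.Lf_pos
  have hLh := hplant.Lh_pos
  have hLF := hF.LF_pos
  have hL0 : 0 < loopLip Lf Lh Lα LF K := by unfold loopLip; positivity
  have hD : -(d + τ) ≤ 0 := by linarith
  have hαc : Continuous α :=
    (LipschitzWith.of_dist_le_mul (K := ⟨Lα, hLα.le⟩) fun x y => by
      rw [dist_eq_norm, dist_eq_norm]; exact hαlip x y).continuous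
  have hhc : Continuous h :=
    (LipschitzWith.of_dist_le_mul (K := ⟨Lh, hLh.le⟩) fun x y => by
      rw [dist_eq_norm, dist_eq_norm]; exact hplant.h_lip x y).continuous
  have hfc := continuous_of_lipschitz₂ hplant.f_lip
  have hFc := continuous_of_lipschitz₃ hF.lip
  obtain ⟨X, hX0, hX⟩ := exists_solution_of_causal_lipschitz
    (G := loopField hD f h α F K m ν) (le_max_of_le_left hδ) hL0
    (fun X Y t ht S hS => norm_loopField_sub_le hδ hd hτ hplant hLα.le hαlip hF hK hD ν X Y ht hS)
    (fun t _ => norm_loopField_zero_le hplant hLα.le hα.zero hF hK hD ν t)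
    (fun X t _ => continuousWithinAt_loopField hfc hFc hhc hαc hD ν X t)
    (fun X => stronglyMeasurable_loopField hfc hFc hhc hαc hD ν X)
    ⟨fun θ => (ψ θ, fun i => φ i θ), by fun_prop⟩
  have hpred : ∀ i, ∀ t, 0 ≤ t → HasDerivWithinAt (predictorPart X i)
      ((loopField hD f h α F K m ν X t).2 i) (Ici t) t := fun i t ht =>
    hasDerivWithinAt_pi.1 (hX t ht).snd i
  refine ⟨appliedInput hD α ν (predictorPart X (Fin.last m)), plantPart X, predictorPart X,
    ?_, fun i => ?_, fun θ hθ => ?_, fun t ht => ?_, fun t ht => (hX t ht).fst,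
    fun t ht => hpred 0 t ht, fun i t ht => hpred i.succ t ht⟩
  · refine ContinuousMap.ext fun θ => ?_
    simp [seg, plantPart, hX0 θ]
  · refine ContinuousMap.ext fun θ => ?_
    simp [seg, predictorPart, hX0 θ]
  · simp [appliedInput, hθ]
  · simp [appliedInput, not_lt.2 ht]

theorem isClassKL_mul_exp {C μ : ℝ} (hC : 0 < C) (hμ : 0 < μ) :
    IsClassKL fun s t => C * s * Real.exp (-μ * t) where
  continuousOn := by fun_prop
  classK t _ :=
    { continuousOn := by fun_prop
      strictMonoOn := fun a _ b _ hab => by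
        simp only
        gcongr
      zero := by simp }
  antitoneOn s hs a _ b _ hab := by
    have : 0 ≤ C * s := mul_nonneg hC.le hs
    simp only
    gcongr 2
    nlinarith
  tendsto s _ := by
    have h1 : Tendsto (fun t : ℝ => C * s * Real.exp (-(μ * t))) atTop (𝓝 (C * s * 0)) :=
      (Real.tendsto_exp_neg_atTop_nhds_zero.comp (tendsto_id.const_mul_atTop hμ)).const_mul _
    simpa [neg_mul] using h1

theorem theorem3 {n p q : ℕ} {δ d τ : ℝ} (hδ : 0 < δ) (hd : 0 < d) (hτ : 0 < τ)
    (f : Hist δ n → Vec p → Vec n) (h : Vec n → Vec q) (Lf Lh : ℝ)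
    (hplant : IsGLCPlant f h Lf Lh)
    (α : Vec n → Vec p) (hα : IsExpStabilizer f α)
    (F : Hist δ n → Vec p → Vec q → Vec n) (LF : ℝ) (hF : IsExpObserver f h d F LF)
    (m : ℕ) (hm : (LF + LF * Lh + 1) ^ 2 * (d + τ) < m) :
    ClosedLoopGAS d τ f h α F (LF + LF * Lh + 1) m := by
  have hLF := hF.LF_pos
  have hLh := hplant.Lh_pos
  have hx := LoopTrajectory.uniformExpDecay_plant (m := m) hδ hd hτ hplant hα hF rfl hm
  have hz := LoopTrajectory.uniformExpDecay_predictor (m := m) hδ hd hτ hplant hα hF rfl hm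
  have hx' := hx.of_norm_le LoopTrajectory.size_nonneg (w := fun ω t => ‖ω.x t‖) 1
    fun ω t _ => by simp
  have hz' := UniformExpDecay.sum LoopTrajectory.size_nonneg Finset.univ
    (v := fun i ω t => ‖ω.z i t‖) fun i =>
      (hz i).of_norm_le LoopTrajectory.size_nonneg 1 fun ω t _ => by simp
  -- Passing to the real signals ‖x‖ and ‖z_i‖ lets the decay calculus bound their sum with one
  -- constant and one rate.
  obtain ⟨C, μ, hC, hμ, hb⟩ := hx'.add LoopTrajectory.size_nonneg hz'
  refine ⟨fun s t => C * s * Real.exp (-μ * t), isClassKL_mul_exp hC hμ, fun ψ φ ν =>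
    ⟨exists_isClosedLoopSolution hδ.le hd hτ hplant hα hF (by positivity) ψ φ ν,
      fun u x z hsol t ht => ?_⟩⟩
  exact (Real.le_norm_self _).trans (hb ⟨ψ, φ, ν, u, x, z, hsol⟩ t ht)
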